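/- Let $\mathbb{F}$ be a field, let $e\ge 2$ and $k\ge j\ge 1$ be integers, put $I=\mathbb{Z}/e\mathbb{Z}$, $n=ke+je$, $\kappa=(0,0)\in I^2$ and $\Lambda=2\Lambda_0$. Let $\mathscr{R}_n^\Lambda=\bigoplus_{\alpha}\mathscr{R}_\alpha^{\Lambda}$ (sum over the $\alpha=\sum_{a\in I}c_a\alpha_a$ with $\sum_a c_a=n$) be the cyclotomic Khovanov–Lauda–Rouquier algebra of type $A^{(1)}_{e-1}$ over $\mathbb{F}$, with generators $e(\mathbf i)$ $(\mathbf i\in I^n)$, $y_1,\dots,y_n$, $\psi_1,\dots,\psi_{n-1}$, graded by $\deg e(\mathbf i)=0$, $\deg y_r=2$, $\deg \psi_re(\mathbf i)=-a_{i_r,i_{r+1}}$, where $a_{ab}=2\delta_{a,b}-\delta_{a,b+1}-\delta_{a,b-1}$. The relations, for all admissible indices, are: $e(\mathbf i)e(\mathbf j)=\delta_{\mathbf i,\mathbf j}e(\mathbf i)$; $\sum_{\mathbf i}e(\mathbf i)=1$; $y_re(\mathbf i)=e(\mathbf i)y_r$; $\psi_re(\mathbf i)=e(s_r\mathbf i)\psi_r$;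 $y_ry_s=y_sy_r$; $\psi_ry_s=y_s\psi_r$ if $s\ne r,r+1$; $\psi_r\psi_s=\psi_s\psi_r$ if $|r-s|>1$; $y_r\psi_re(\mathbf i)=(\psi_ry_{r+1}-\delta_{i_r,i_{r+1}})e(\mathbf i)$; $y_{r+1}\psi_re(\mathbf i)=(\psi_ry_r+\delta_{i_r,i_{r+1}})e(\mathbf i)$; the quadratic relation that $\psi_r^2e(\mathbf i)$ equals $0$ if $i_r=i_{r+1}$, $e(\mathbf i)$ if $i_{r+1}\ne i_r,i_r\pm1$, and, for $e>2$, $(y_{r+1}-y_r)e(\mathbf i)$ if $i_r=i_{r+1}+1$ and $(y_r-y_{r+1})e(\mathbf i)$ if $i_r=i_{r+1}-1$, while for $e=2$ it equals $(y_{r+1}-y_r)(y_r-y_{r+1})e(\mathbf i)$ if $i_r\ne i_{r+1}$; the braid relation $\psi_r\psi_{r+1}\psi_re(\mathbf i)=(\psi_{r+1}\psi_r\psi_{r+1}+\beta)e(\mathbf i)$, where for $e>2$ we have $\beta=1$ if $i_{r+2}=i_r=i_{r+1}+1$ and $\beta=-1$ if $i_{r+2}=i_r=i_{r+1}-1$,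 for $e=2$ we have $\beta=y_r-2y_{r+1}+y_{r+2}$ if $i_{r+2}=i_r\ne i_{r+1}$, and $\beta=0$ in all other cases; and the cyclotomic relation $y_1^{2\delta_{i_1,0}}e(\mathbf i)=0$. For a bipartition $\nu$ of $n$, let $\mathtt t_\nu$ be the column-initial $\nu$-tableau, in which $1,\dots,n$ appear in order down consecutive columns from left to right, first in component $2$, then in component $1$. Let $\mathbf i_\nu$ be its residue sequence, the node in row $a$ and column $b$ of either component having residue $b-a\in I$. Let $\operatorname{codeg}(\mathtt t_\nu)$ be its codegree: the sum over $r=1,\dots,n$ of the number of addable minus the number of removable nodes, of the same residue as the node containing $r$ and above that node, of the diagram formed by the nodes with entries $\le r$; here a node is above another if it lies in an earlier component, or in the same component in an earlier row. Let $\mu=((ke),(je))$ and $\lambda=((ke,je-e+1),(e-1))$. The graded (column) Specht module $S^\mu$ is the cyclic left $\mathscr{R}_n^\Lambda$-module with generator $z_\mu$ of degree $\operatorname{codeg}(\mathtt t_\mu)$ and relations $$e(\mathbf i_\mu)z_\mu=z_\mu,\qquad y_rz_\mu=0\ (1\le r\le n),\qquad \psi_rz_\mu=0\ (1\le r\le n-1,\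 r\ne je).$$ The graded (column) Specht module $S^\lambda$ is the cyclic left $\mathscr{R}_n^\Lambda$-module with generator $z_\lambda$ of degree $\operatorname{codeg}(\mathtt t_\lambda)$ and relations - $e(\mathbf i_\lambda)z_\lambda=z_\lambda$, and $y_rz_\lambda=0$ for $1\le r\le n$; - $\psi_rz_\lambda=0$ for $r\in\{1,\dots,e-2\}\cup\{e,e+2,\dots,2je-e\}\cup\{2je-e+2,\dots,n-1\}$; - $\psi_r\psi_{r+1}z_\lambda=0$ for $r\in\{e,e+2,\dots,2je-e\}$; - $\psi_r\psi_{r-1}z_\lambda=0$ for $r\in\{e+2,e+4,\dots,2je-e\}$. For $1\le a_1<\dots<a_{je}\le n$ let $v(a_1,\dots,a_{je})=(\psi_{a_1-1}\psi_{a_1-2}\cdots\psi_1)(\psi_{a_2-1}\cdots\psi_2)\cdots(\psi_{a_{je}-1}\cdots\psi_{je})z_\mu\in S^\mu$, the $s$-th factor being $1$ if $a_s=s$; this is the standard basis vector of $S^\mu$ labelled by the standard $\mu$-tableau with entries $a_1,\dots,a_{je}$ in its second component. **Proposition.** There is a homomorphism of $\mathscr{R}_n^\Lambda$-modules $\gamma_{k,j}\colon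 S^{\lambda}\to S^{\mu}$, homogeneous of degree $j$ (that is, $\gamma_{k,j}(S^\lambda_d)\subseteq S^\mu_{d+j}$ for all $d\in\mathbb{Z}$), with $$\gamma_{k,j}(z_\lambda)=v(1,2,\dots,e-1,e+1,e+3,e+5,\dots,2je-e+1).$$ -/

import Mathlib

namespace BihookSpecht

/-! ### Bipartitions, nodes, tableaux, residues, codegrees -/

/-- A bipartition of `n`: two weakly decreasing lists of parts, `part 0` being the first component
and `part 1` the second one, with `n` nodes altogether. -/
structure Bipartition (n : ℕ) where
  part : Fin 2 → List ℕ
  sorted : ∀ m, (part m).SortedGE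
  size : (part 0).sum + (part 1).sum = n

/-- A node `(m, i, j)`: component `m`, row `i`, column `j`, all counted from `0`. -/
abbrev Node : Type := Fin 2 × ℕ × ℕ

/-- The residue `κ_m + j - i` of a node. -/
def res {e : ℕ} (κ : Fin 2 → ZMod e) (A : Node) : ZMod e :=
  κ A.1 + (A.2.2 : ZMod e) - (A.2.1 : ZMod e)

/-- A finite set of nodes is the Young diagram of a bipartition: in each component it is closed
under moving up and to the left. -/
def IsDiagram (D : Finset Node) : Prop :=
  ∀ m i j, (m, i, j) ∈ D → ∀ i' j', i' ≤ i → j' ≤ j → (m, i', j') ∈ D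

/-- `A` is an addable node of the diagram `D`. -/
def Addable (D : Finset Node) (A : Node) : Prop := A ∉ D ∧ IsDiagram (insert A D)

/-- `A` is a removable node of the diagram `D`. -/
def Removable (D : Finset Node) (A : Node) : Prop := A ∈ D ∧ IsDiagram (D.erase A)

/-- `B` is above `A`: in an earlier component, or in the same component in an earlier row. -/
def Above (B A : Node) : Prop := B.1 < A.1 ∨ (B.1 = A.1 ∧ B.2.1 < A.2.1)

/-- The number of addable minus the number of removable nodes of `D`, of the same residue as `A`
and above `A`. -/
noncomputable def dAbove {e : ℕ} (κ : Fin 2 → ZMod e) (D : Finset Node) (A : Node) : ℤ :=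
  ({B : Node | Addable D B ∧ res κ B = res κ A ∧ Above B A}.ncard : ℤ)
    - ({B : Node | Removable D B ∧ res κ B = res κ A ∧ Above B A}.ncard : ℤ)

/-- The codegree of a standard tableau. The tableau is given by the inverse map `T`: `T r` is the
node holding the entry `r + 1`. Unrolling the recursion, the codegree is the sum over all entries
of `dAbove` for the diagram formed by the entries up to that one. -/
noncomputable def codeg {e n : ℕ} (κ : Fin 2 → ZMod e) (T : Fin n → Node) : ℤ :=
  ∑ r : Fin n, dAbove κ ((Finset.univ.filter (fun s : Fin n => s ≤ r)).image T) (T r)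

/-- The nodes of one component, listed down consecutive columns from left to right; the `c`-th
column has as many nodes as there are parts exceeding `c`. -/
def componentNodes (m : Fin 2) (l : List ℕ) : List Node :=
  (List.range (l.headD 0)).flatMap fun c =>
    (List.range (l.countP fun x => c < x)).map fun i => (m, i, c)

/-- All nodes of a bipartition in the order of the column-initial tableau: down consecutive
columns, first in the second component, then in the first one. -/
def columnNodes {n : ℕ} (ν : Bipartition n) : List Node :=
  componentNodes 1 (ν.part 1) ++ componentNodes 0 (ν.part 0)

theorem sum_countP (l : List ℕ) (N : ℕ) (h : ∀ x ∈ l, x ≤ N) :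
    ((List.range N).map fun c => l.countP fun x => c < x).sum = l.sum := by
  induction l with
  | nil => simp
  | cons a t ih =>
    have hN : ∀ N, ((List.range N).map fun c => if c < a then 1 else 0).sum = min N a := by
      intro N
      induction N with
      | zero => simp
      | succ N ihN =>
        rw [List.range_succ, List.map_append, List.sum_append, ihN]
        simp only [List.map_cons, List.map_nil, List.sum_cons, List.sum_nil]
        split_ifs <;> omega
    have ha : a ≤ N := h a (by simp)
    have ht := ih (fun x hx => h x (by simp [hx]))
    have hs := hN N
    rw [min_eq_right ha] at hs
    simp only [List.countP_cons, decide_eq_true_eq, List.sum_cons, List.sum_map_add]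
    omega

theorem length_componentNodes (m : Fin 2) (l : List ℕ) (h : l.SortedGE) :
    (componentNodes m l).length = l.sum := by
  have hle : ∀ x ∈ l, x ≤ l.headD 0 := by
    have hp := h.pairwise
    cases l with
    | nil => simp
    | cons a t =>
      intro x hx
      rcases List.mem_cons.1 hx with rfl | hx
      · simp
      · simpa using (List.pairwise_cons.1 hp).1 x hx
  simpa [componentNodes, List.length_flatMap] using sum_countP l _ hle

theorem length_columnNodes {n : ℕ} (ν : Bipartition n) : (columnNodes ν).length = n := by
  rw [columnNodes, List.length_append, length_componentNodes _ _ (ν.sorted 1),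
    length_componentNodes _ _ (ν.sorted 0), add_comm, ν.size]

/-- The column-initial tableau of `ν` (as inverse map: entry `r + 1` lies in the node at `r`). -/
def colInitial {n : ℕ} (ν : Bipartition n) (r : Fin n) : Node :=
  (columnNodes ν).get (Fin.cast (length_columnNodes ν).symm r)

/-- The residue sequence of the column-initial tableau. -/
def colResidues {e n : ℕ} (κ : Fin 2 → ZMod e) (ν : Bipartition n) : Fin n → ZMod e :=
  fun r => res κ (colInitial ν r)

/-! ### Cyclotomic KLR algebras of type `A_{e-1}^{(1)}` -/

/-- The entry `a_{ij}` of the generalised Cartan matrix. -/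
def cartan {e : ℕ} (i j : ZMod e) : ℤ :=
  (if i = j then 2 else 0) - (if i = j + 1 then 1 else 0) - (if i = j - 1 then 1 else 0)

/-- The entry `i_r` of a sequence `i = (i_1, …, i_n)` (used for `1 ≤ r ≤ n` only). -/
def nth {e n : ℕ} (i : Fin n → ZMod e) (r : ℕ) : ZMod e :=
  if h : r - 1 < n then i ⟨r - 1, h⟩ else 0

/-- The sequence `s_r i`, with the entries at places `r` and `r + 1` exchanged. -/
def swapSeq {e n : ℕ} (r : ℕ) (i : Fin n → ZMod e) : Fin n → ZMod e :=
  fun t => nth i (Equiv.swap r (r + 1) ((t : ℕ) + 1))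

/-- The coefficients of `α_{i_1} + … + α_{i_n}` in the simple roots. -/
def content {e n : ℕ} (i : Fin n → ZMod e) : ZMod e → ℕ :=
  fun a => (Finset.univ.filter fun t => i t = a).card

/-- Generators `e(i)`, `y_r`, `ψ_r`. For uniformity they are indexed by all sequences and all
natural numbers; those outside the proper index sets are set to zero by the relations. -/
inductive Gen (e n : ℕ) : Type
  | idem (i : Fin n → ZMod e)
  | y (r : ℕ)
  | psi (r : ℕ)

section Relations

variable {A : Type*} [Ring A]

/-- The right-hand side of the quadratic relation `ψ_r² e(i) = quad i_r i_{r+1} y_r y_{r+1} e(i)`.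
The second case is the one where `a = b + 1` and `a = b - 1` hold together. -/
def quad {e : ℕ} (a b : ZMod e) (y y' : A) : A :=
  if a = b then 0
  else if e = 2 then (y' - y) * (y - y')
  else if a = b + 1 then y' - y
  else if a = b - 1 then y - y'
  else 1

/-- The correction term of the braid relation
`ψ_r ψ_{r+1} ψ_r e(i) = (ψ_{r+1} ψ_r ψ_{r+1} + braid …) e(i)`. -/
def braid {e : ℕ} (a b c : ZMod e) (y y' y'' : A) : A :=
  if c = a ∧ a ≠ b then
    if e = 2 then y - 2 * y' + y''
    else if a = b + 1 then 1
    else if a = b - 1 then -1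
    else 0
  else 0

end Relations

section KLR

variable (F : Type*) [Field F] {e : ℕ} [NeZero e] (n : ℕ) (κ : Fin 2 → ZMod e)

/-- The integer `(Λ, α_a)` for `Λ = Λ_{κ_1} + Λ_{κ_2}`. -/
def level (a : ZMod e) : ℕ := (if κ 0 = a then 1 else 0) + (if κ 1 = a then 1 else 0)

/-- The generators in the free algebra. -/
def fE (i : Fin n → ZMod e) : FreeAlgebra F (Gen e n) := FreeAlgebra.ι F (Gen.idem i)

/-- The generators in the free algebra. -/
def fY (e n : ℕ) (r : ℕ) : FreeAlgebra F (Gen e n) := FreeAlgebra.ι F (Gen.y r)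

/-- The generators in the free algebra. -/
def fP (e n : ℕ) (r : ℕ) : FreeAlgebra F (Gen e n) := FreeAlgebra.ι F (Gen.psi r)

/-- The defining relations of the cyclotomic KLR algebra `R_α^Λ`, for `α = ∑ α_a` given by its
coefficients. The first three set the superfluous generators to zero. -/
inductive Rel (α : ZMod e → ℕ) : FreeAlgebra F (Gen e n) → FreeAlgebra F (Gen e n) → Prop
  | idem_out (i : Fin n → ZMod e) (h : content i ≠ α) : Rel α (fE F n i) 0
  | y_out (r : ℕ) (h : ¬ (1 ≤ r ∧ r ≤ n)) : Rel α (fY F e n r) 0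
  | psi_out (r : ℕ) (h : ¬ (1 ≤ r ∧ r + 1 ≤ n)) : Rel α (fP F e n r) 0
  | idem_mul (i j : Fin n → ZMod e) :
      Rel α (fE F n i * fE F n j) (if i = j then fE F n i else 0)
  | idem_sum : Rel α (∑ i : Fin n → ZMod e, fE F n i) 1
  | y_idem (r : ℕ) (i : Fin n → ZMod e) : Rel α (fY F e n r * fE F n i) (fE F n i * fY F e n r)
  | psi_idem (r : ℕ) (i : Fin n → ZMod e) (h₁ : 1 ≤ r) (h₂ : r + 1 ≤ n) :
      Rel α (fP F e n r * fE F n i) (fE F n (swapSeq r i) * fP F e n r)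
  | y_comm (r s : ℕ) : Rel α (fY F e n r * fY F e n s) (fY F e n s * fY F e n r)
  | psi_y (r s : ℕ) (h₁ : s ≠ r) (h₂ : s ≠ r + 1) :
      Rel α (fP F e n r * fY F e n s) (fY F e n s * fP F e n r)
  | psi_comm (r s : ℕ) (h : r + 1 < s ∨ s + 1 < r) :
      Rel α (fP F e n r * fP F e n s) (fP F e n s * fP F e n r)
  | y_psi (r : ℕ) (i : Fin n → ZMod e) (h₁ : 1 ≤ r) (h₂ : r + 1 ≤ n) :
      Rel α (fY F e n r * fP F e n r * fE F n i)
        ((fP F e n r * fY F e n (r + 1) - (if nth i r = nth i (r + 1) then 1 else 0)) * fE F n i)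
  | y_succ_psi (r : ℕ) (i : Fin n → ZMod e) (h₁ : 1 ≤ r) (h₂ : r + 1 ≤ n) :
      Rel α (fY F e n (r + 1) * fP F e n r * fE F n i)
        ((fP F e n r * fY F e n r + (if nth i r = nth i (r + 1) then 1 else 0)) * fE F n i)
  | psi_sq (r : ℕ) (i : Fin n → ZMod e) (h₁ : 1 ≤ r) (h₂ : r + 1 ≤ n) :
      Rel α (fP F e n r * fP F e n r * fE F n i)
        (quad (nth i r) (nth i (r + 1)) (fY F e n r) (fY F e n (r + 1)) * fE F n i)
  | psi_braid (r : ℕ) (i : Fin n → ZMod e) (h₁ : 1 ≤ r) (h₂ : r + 2 ≤ n) :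
      Rel α (fP F e n r * fP F e n (r + 1) * fP F e n r * fE F n i)
        ((fP F e n (r + 1) * fP F e n r * fP F e n (r + 1)
          + braid (nth i r) (nth i (r + 1)) (nth i (r + 2))
              (fY F e n r) (fY F e n (r + 1)) (fY F e n (r + 2))) * fE F n i)
  | cyclotomic (i : Fin n → ZMod e) (h : 1 ≤ n) :
      Rel α (fY F e n 1 ^ level κ (nth i 1) * fE F n i) 0

/-- The cyclotomic KLR algebra `R_α^Λ`. -/
abbrev Block (α : ZMod e → ℕ) : Type _ := RingQuot (Rel F n κ α)

/-- The image of an element of the free algebra in `R_α^Λ`. -/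
noncomputable def toBlock (α : ZMod e → ℕ) : FreeAlgebra F (Gen e n) →ₐ[F] Block F n κ α :=
  RingQuot.mkAlgHom F (Rel F n κ α)

/-- The cyclotomic KLR algebra `R_n^Λ`, the direct sum of the (finitely many) algebras `R_α^Λ`
over all `α` of height `n`. -/
abbrev CycKLR : Type _ := (α : {α : ZMod e → ℕ // ∑ a, α a = n}) → Block F n κ α.1

variable {n}

/-- The idempotent `e(i)` of `R_n^Λ`. -/
noncomputable def idem (i : Fin n → ZMod e) : CycKLR F n κ :=
  fun α => toBlock F n κ α.1 (fE F n i)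

variable (n)

/-- The element `y_r` of `R_n^Λ`, for `1 ≤ r ≤ n`. -/
noncomputable def y (r : ℕ) : CycKLR F n κ := fun α => toBlock F n κ α.1 (fY F e n r)

/-- The element `ψ_r` of `R_n^Λ`, for `1 ≤ r < n`. -/
noncomputable def psi (r : ℕ) : CycKLR F n κ := fun α => toBlock F n κ α.1 (fP F e n r)

/-- `Monomial α d x`: the element `x` of `R_α^Λ` is a product of generators `e(i)` (degree `0`),
`y_r` (degree `2`) and `ψ_r e(i)` (degree `-a_{i_r,i_{r+1}}`) of total degree `d`. -/
inductive Monomial (α : ZMod e → ℕ) : ℤ → Block F n κ α → Prop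
  | idem (i : Fin n → ZMod e) : Monomial α 0 (toBlock F n κ α (fE F n i))
  | y (r : ℕ) {d : ℤ} {x : Block F n κ α} (hx : Monomial α d x) :
      Monomial α (d + 2) (toBlock F n κ α (fY F e n r) * x)
  | psi (r : ℕ) (i : Fin n → ZMod e) (h₁ : 1 ≤ r) (h₂ : r + 1 ≤ n) {d : ℤ} {x : Block F n κ α}
      (hx : Monomial α d x) :
      Monomial α (d - cartan (nth i r) (nth i (r + 1)))
        (toBlock F n κ α (fP F e n r) * toBlock F n κ α (fE F n i) * x)

/-- The homogeneous component of degree `d` of `R_α^Λ`. -/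
noncomputable def blockDeg (α : ZMod e → ℕ) (d : ℤ) : Submodule F (Block F n κ α) :=
  Submodule.span F {x | Monomial F n κ α d x}

/-- The homogeneous component of degree `d` of `R_n^Λ`. -/
noncomputable def klrDeg (d : ℤ) : Submodule F (CycKLR F n κ) :=
  Submodule.pi Set.univ fun α => blockDeg F n κ α.1 d

/-! ### Graded cyclic modules with a column-initial generator -/

variable {n}

/-- The left ideal generated by `e(i_ν) - 1`, all `y_r` and a set `K` of further elements. -/
def spechtIdeal (ν : Bipartition n) (K : Set (CycKLR F n κ)) :
    Submodule (CycKLR F n κ) (CycKLR F n κ) :=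
  Submodule.span (CycKLR F n κ)
    ({idem F κ (colResidues κ ν) - 1} ∪ {x | ∃ r, 1 ≤ r ∧ r ≤ n ∧ x = y F n κ r} ∪ K)

/-- The cyclic left `R_n^Λ`-module with generator `z` and relations `e(i_ν) z = z`, `y_r z = 0`
for all `r`, and `x z = 0` for all `x ∈ K`. -/
abbrev SpechtOf (ν : Bipartition n) (K : Set (CycKLR F n κ)) : Type _ :=
  CycKLR F n κ ⧸ spechtIdeal F κ ν K

/-- The cyclic generator `z`. -/
def gen (ν : Bipartition n) (K : Set (CycKLR F n κ)) : SpechtOf F κ ν K :=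
  Submodule.Quotient.mk 1

/-- The homogeneous component of degree `d` of the module when its generator is placed in degree
`codeg(t_ν)`: the image of the component of degree `d - codeg(t_ν)` of `R_n^Λ` under
`x ↦ x z`. -/
noncomputable def spechtDeg (ν : Bipartition n) (K : Set (CycKLR F n κ)) (d : ℤ) :
    Submodule F (SpechtOf F κ ν K) :=
  (klrDeg F n κ (d - codeg κ (colInitial ν))).map
    ((spechtIdeal F κ ν K).mkQ.restrictScalars F)

/-- `ψ_x ψ_{x-1} … ψ_y`, which is `1` if `x < y`. -/
noncomputable def psiDown (n x y : ℕ) : CycKLR F n κ :=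
  ((List.range' y (x + 1 - y)).reverse.map (psi F n κ)).prod

/-- The product `ψ_{a_1-1}…ψ_1 · ψ_{a_2-1}…ψ_2 · ⋯ · ψ_{a_m-1}…ψ_m`. -/
noncomputable def psiTab (n m : ℕ) (a : ℕ → ℕ) : CycKLR F n κ :=
  ((List.range m).map fun s => psiDown F κ n (a (s + 1) - 1) (s + 1)).prod

end KLR

/-! ### The two families of Specht modules -/

/-- The bipartition `((ke), (je))`. -/
def rowPair (e j k : ℕ) : Bipartition (k * e + j * e) where
  part := ![[k * e], [j * e]]
  sorted := by
    intro m
    fin_cases m <;> simp [List.sortedGE_iff_pairwise]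
  size := by simp

/-- The bipartition `((ke, je - e + 1), (e - 1))`. -/
def twoRowPair (e j k : ℕ) (he : 2 ≤ e) (hj : 1 ≤ j) (hjk : j ≤ k) :
    Bipartition (k * e + j * e) where
  part := ![[k * e, j * e - e + 1], [e - 1]]
  sorted := by
    have h₁ : j * e ≤ k * e := Nat.mul_le_mul_right e hjk
    have h₂ : 1 * e ≤ j * e := Nat.mul_le_mul_right e hj
    intro m
    fin_cases m
    · simp [List.sortedGE_iff_pairwise]
      omega
    · simp [List.sortedGE_iff_pairwise]
  size := by
    have h₂ : 1 * e ≤ j * e := Nat.mul_le_mul_right e hj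
    simp
    omega

section Families

variable (F : Type*) [Field F] {e : ℕ} [NeZero e] (κ : Fin 2 → ZMod e) (j k : ℕ)

/-- The remaining relators of the Specht module of `((ke), (je))`: `ψ_r` for
`r ∈ {1, …, n - 1} \ {je}`, where `n = ke + je`. -/
def rowPairRelators : Set (CycKLR F (k * e + j * e) κ) :=
  {x | ∃ r, 1 ≤ r ∧ r ≤ k * e + j * e - 1 ∧ r ≠ j * e ∧ x = psi F _ κ r}

/-- The remaining relators of the Specht module of `((ke, je - e + 1), (e - 1))`. The numbers
`e, e + 2, …, 2je - e` are written as `e + 2i` with `0 ≤ i ≤ je - e`. -/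
def twoRowPairRelators : Set (CycKLR F (k * e + j * e) κ) :=
  {x | ∃ r, 1 ≤ r ∧ r ≤ e - 2 ∧ x = psi F _ κ r}
  ∪ {x | ∃ i, i ≤ j * e - e ∧ x = psi F _ κ (e + 2 * i)}
  ∪ {x | ∃ r, 2 * (j * e) - e + 2 ≤ r ∧ r ≤ k * e + j * e - 1 ∧ x = psi F _ κ r}
  ∪ {x | ∃ i, i ≤ j * e - e ∧ x = psi F _ κ (e + 2 * i) * psi F _ κ (e + 2 * i + 1)}
  ∪ {x | ∃ i, 1 ≤ i ∧ i ≤ j * e - e ∧ x = psi F _ κ (e + 2 * i) * psi F _ κ (e + 2 * i - 1)}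

end Families

/-- The entries `1, 2, …, e - 1, e + 1, e + 3, …, 2je - e + 1` (for `s = 1, …, je`). -/
def gammaEntry (e s : ℕ) : ℕ := if s < e then s else 2 * s - e + 1

end BihookSpecht

/-! The module `SpechtOf F κ ν K` is cyclic, so a homomorphism to `S^μ` with `z_λ ↦ v` exists as
soon as `v` is killed by the relators of `S^λ` (`exists_linearMap_gen`). Everything therefore rests
on these vanishing statements. They are obtained from weights and degrees alone, without computing
in the algebra and without knowing that the standard vectors are linearly independent.

Write `m = je`. A standard `μ`-tableau is a lattice path `c`, where `c p` counts the entries at most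
`p` in the second component. Lowering a peak of the path is a crossing `ψ`, and `Reach` records the
vectors obtained from `z_μ` in this way. A path determines a residue sequence (`pathSeq`) and a
degree relative to `z_μ` (`pathDeg`). The key structural fact is `actsUpTo`: each `y_r`, and each
`ψ_r` away from a peak, sends a path vector to a combination of path vectors with fewer crossings
and with the expected residue sequence and degree. The induction uses the quadratic and braid
relations; `Reach.exists_of_valley` reorders crossings so that the braid relation applies.

Hence a relator applied to `v` lies in the span of path vectors of one prescribed residue sequence
and degree, and it vanishes if no path has both (`eq_zero_of_mem_reachSpan`). The nonexistence is
combinatorial (`pathDeg_ne_of_pathSeq_eq` and its three `swapSeq` variants). For `e > 2` the two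
residues available along the path of `v` differ after the start, so residues determine a path up to
reflection; the endpoint rules out the reflection and the degree rules out the remaining candidate.
For `e = 2` residues say little, but the path of `v` is the unique one of maximal degree. The `ψ_r`
at the two ends commute past all crossings in `v` and kill `z_μ`.

For the grading, `v` has degree `pathDeg` of its path relative to `z_μ` (`Reach.mul_mem_klrDeg`). By
`codeg_twoRowPair` this number is the codegree of `t_λ`, whereas `t_μ` has codegree `j`
(`codeg_rowPair`). The difference of degrees is thus `j`. -/

namespace BihookSpecht

/-! ### Place permutations acting on residue sequences -/

section Sequences

variable {e n : ℕ}

theorem seq_ext_nth {i i' : Fin n → ZMod e}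
    (h : ∀ s, 1 ≤ s → s ≤ n → nth i s = nth i' s) : i = i' := by
  funext t
  have := h (t + 1) (by omega) t.2
  simpa [nth] using this

theorem nth_swapSeq (r : ℕ) (i : Fin n → ZMod e) (s : ℕ) (h₁ : 1 ≤ s) (h₂ : s ≤ n) :
    nth (swapSeq r i) s = nth i (Equiv.swap r (r + 1) s) := by
  have h : s - 1 < n := by omega
  have h' : s - 1 + 1 = s := by omega
  rw [nth, dif_pos h, swapSeq]
  simp only [h']

theorem nth_swapSeq_left (r : ℕ) (i : Fin n → ZMod e) (h₁ : 1 ≤ r) (h₂ : r + 1 ≤ n) :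
    nth (swapSeq r i) r = nth i (r + 1) := by
  rw [nth_swapSeq r i r h₁ (by omega), Equiv.swap_apply_left]

theorem nth_swapSeq_right (r : ℕ) (i : Fin n → ZMod e) (h₂ : r + 1 ≤ n) :
    nth (swapSeq r i) (r + 1) = nth i r := by
  rw [nth_swapSeq r i _ (by omega) (by omega), Equiv.swap_apply_right]

theorem nth_swapSeq_of_ne (r : ℕ) (i : Fin n → ZMod e) (s : ℕ) (h₁ : 1 ≤ s) (h₂ : s ≤ n)
    (hs : s ≠ r) (hs' : s ≠ r + 1) : nth (swapSeq r i) s = nth i s := by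
  rw [nth_swapSeq r i s h₁ h₂, Equiv.swap_apply_of_ne_of_ne hs hs']

theorem swapSeq_swapSeq (r : ℕ) (i : Fin n → ZMod e) (h₁ : 1 ≤ r) (h₂ : r + 1 ≤ n) :
    swapSeq r (swapSeq r i) = i := by
  refine seq_ext_nth fun s hs hs' => ?_
  rcases eq_or_ne s r with rfl | h
  · rw [nth_swapSeq_left _ _ h₁ h₂, nth_swapSeq_right _ _ h₂]
  rcases eq_or_ne s (r + 1) with rfl | h'
  · rw [nth_swapSeq_right _ _ h₂, nth_swapSeq_left _ _ h₁ h₂]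
  rw [nth_swapSeq_of_ne _ _ _ hs hs' h h', nth_swapSeq_of_ne _ _ _ hs hs' h h']

theorem swapSeq_comm (r t : ℕ) (i : Fin n → ZMod e) (hr : 1 ≤ r) (hr' : r + 1 ≤ n) (ht : 1 ≤ t)
    (ht' : t + 1 ≤ n) (h : r + 1 < t ∨ t + 1 < r) :
    swapSeq r (swapSeq t i) = swapSeq t (swapSeq r i) := by
  refine seq_ext_nth fun s hs hs' => ?_
  have key : ∀ a, 1 ≤ a → a + 1 ≤ n →
      1 ≤ Equiv.swap a (a + 1) s ∧ Equiv.swap a (a + 1) s ≤ n := by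
    intro a h₁ h₂
    rw [Equiv.swap_apply_def]
    split_ifs <;> omega
  rw [nth_swapSeq _ _ _ hs hs', nth_swapSeq _ _ _ (key r hr hr').1 (key r hr hr').2,
    nth_swapSeq _ _ _ hs hs', nth_swapSeq _ _ _ (key t ht ht').1 (key t ht ht').2]
  congr 1
  simp only [Equiv.swap_apply_def]
  split_ifs <;> omega

theorem swapSeq_braid (r : ℕ) (i : Fin n → ZMod e) (hr : 1 ≤ r) (hr' : r + 2 ≤ n) :
    swapSeq r (swapSeq (r + 1) (swapSeq r i))
      = swapSeq (r + 1) (swapSeq r (swapSeq (r + 1) i)) := by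
  refine seq_ext_nth fun s hs hs' => ?_
  have key : ∀ a b, 1 ≤ a → a + 1 ≤ n → 1 ≤ b → b ≤ n →
      1 ≤ Equiv.swap a (a + 1) b ∧ Equiv.swap a (a + 1) b ≤ n := by
    intro a b h₁ h₂ h₃ h₄
    rw [Equiv.swap_apply_def]
    split_ifs <;> omega
  have k1 := key r s hr (by omega) hs hs'
  have k2 := key (r + 1) s (by omega) (by omega) hs hs'
  have k3 := key (r + 1) _ (by omega) (by omega) k1.1 k1.2
  have k4 := key r _ (by omega) (by omega) k2.1 k2.2
  rw [nth_swapSeq _ _ _ hs hs', nth_swapSeq _ _ _ k1.1 k1.2, nth_swapSeq _ _ _ k3.1 k3.2,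
    nth_swapSeq _ _ _ hs hs', nth_swapSeq _ _ _ k2.1 k2.2, nth_swapSeq _ _ _ k4.1 k4.2]
  congr 1
  simp only [Equiv.swap_apply_def]
  split_ifs <;> omega

theorem swapSeq_eq_self (r : ℕ) (i : Fin n → ZMod e) (h₁ : 1 ≤ r) (h₂ : r + 1 ≤ n)
    (h : nth i r = nth i (r + 1)) : swapSeq r i = i := by
  refine seq_ext_nth fun s hs hs' => ?_
  rcases eq_or_ne s r with rfl | hr
  · rw [nth_swapSeq_left _ _ h₁ h₂, h]
  rcases eq_or_ne s (r + 1) with rfl | h'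
  · rw [nth_swapSeq_right _ _ h₂, h]
  rw [nth_swapSeq_of_ne _ _ _ hs hs' hr h']

theorem swapSeq_braid_eq_self (r : ℕ) (i : Fin n → ZMod e) (hr : 1 ≤ r) (hr' : r + 2 ≤ n)
    (h : nth i (r + 2) = nth i r) : swapSeq r (swapSeq (r + 1) (swapSeq r i)) = i := by
  have h1 : swapSeq (r + 1) (swapSeq r i) = swapSeq r i := by
    refine swapSeq_eq_self _ _ (by omega) (by omega) ?_
    rw [nth_swapSeq_right _ _ (by omega),
      nth_swapSeq_of_ne _ _ _ (by omega) (by omega) (by omega) (by omega), h]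
  rw [h1, swapSeq_swapSeq _ _ hr (by omega)]

end Sequences

/-! ### The defining relations, transported to the cyclotomic algebra -/

section Relations

variable (F : Type*) [Field F] {e : ℕ} [NeZero e] (n : ℕ) (κ : Fin 2 → ZMod e)

theorem toBlock_rel {α : ZMod e → ℕ} {a b : FreeAlgebra F (Gen e n)} (h : Rel F n κ α a b) :
    toBlock F n κ α a = toBlock F n κ α b :=
  RingQuot.mkAlgHom_rel F h

theorem y_out (r : ℕ) (h : ¬ (1 ≤ r ∧ r ≤ n)) : y F n κ r = 0 := by
  funext α
  exact (toBlock_rel F n κ (Rel.y_out (α := α.1) r h)).trans (map_zero _)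

theorem idem_mul_idem (i j : Fin n → ZMod e) :
    idem F κ i * idem F κ j = if i = j then idem F κ i else 0 := by
  funext α
  have h := toBlock_rel F n κ (Rel.idem_mul (α := α.1) i j)
  rw [map_mul] at h
  split_ifs at h ⊢ with hij
  · exact h
  · rw [map_zero] at h; exact h

theorem psi_mul_idem (r : ℕ) (i : Fin n → ZMod e) (h₁ : 1 ≤ r) (h₂ : r + 1 ≤ n) :
    psi F n κ r * idem F κ i = idem F κ (swapSeq r i) * psi F n κ r := by
  funext α
  have h := toBlock_rel F n κ (Rel.psi_idem (α := α.1) r i h₁ h₂)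
  simp only [map_mul] at h
  exact h

theorem psi_mul_y (r s : ℕ) (h₁ : s ≠ r) (h₂ : s ≠ r + 1) :
    psi F n κ r * y F n κ s = y F n κ s * psi F n κ r := by
  funext α
  have h := toBlock_rel F n κ (Rel.psi_y (α := α.1) r s h₁ h₂)
  simp only [map_mul] at h
  exact h

theorem psi_mul_psi (r s : ℕ) (h₁ : r + 1 < s ∨ s + 1 < r) :
    psi F n κ r * psi F n κ s = psi F n κ s * psi F n κ r := by
  funext α
  have h := toBlock_rel F n κ (Rel.psi_comm (α := α.1) r s h₁)
  simp only [map_mul] at h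
  exact h

theorem y_mul_psi_mul_idem (r : ℕ) (i : Fin n → ZMod e) (h₁ : 1 ≤ r) (h₂ : r + 1 ≤ n) :
    y F n κ r * psi F n κ r * idem F κ i
      = (psi F n κ r * y F n κ (r + 1) - (if nth i r = nth i (r + 1) then 1 else 0))
        * idem F κ i := by
  funext α
  have h := toBlock_rel F n κ (Rel.y_psi (α := α.1) r i h₁ h₂)
  split_ifs at h ⊢ <;> simp only [map_mul, map_sub, map_one, map_zero] at h <;> exact h

theorem y_succ_mul_psi_mul_idem (r : ℕ) (i : Fin n → ZMod e) (h₁ : 1 ≤ r) (h₂ : r + 1 ≤ n) :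
    y F n κ (r + 1) * psi F n κ r * idem F κ i
      = (psi F n κ r * y F n κ r + (if nth i r = nth i (r + 1) then 1 else 0))
        * idem F κ i := by
  funext α
  have h := toBlock_rel F n κ (Rel.y_succ_psi (α := α.1) r i h₁ h₂)
  split_ifs at h ⊢ <;> simp only [map_mul, map_add, map_one, map_zero] at h <;> exact h

theorem psi_mul_psi_mul_idem (r : ℕ) (i : Fin n → ZMod e) (h₁ : 1 ≤ r) (h₂ : r + 1 ≤ n) :
    psi F n κ r * psi F n κ r * idem F κ i
      = quad (nth i r) (nth i (r + 1)) (y F n κ r) (y F n κ (r + 1)) * idem F κ i := by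
  funext α
  have h := toBlock_rel F n κ (Rel.psi_sq (α := α.1) r i h₁ h₂)
  unfold quad at h ⊢
  split_ifs at h ⊢ <;> simp only [map_mul, map_sub, map_one, map_zero] at h <;> exact h

theorem psi_braid_mul_idem (r : ℕ) (i : Fin n → ZMod e) (h₁ : 1 ≤ r) (h₂ : r + 2 ≤ n) :
    psi F n κ r * psi F n κ (r + 1) * psi F n κ r * idem F κ i
      = (psi F n κ (r + 1) * psi F n κ r * psi F n κ (r + 1)
          + braid (nth i r) (nth i (r + 1)) (nth i (r + 2))
            (y F n κ r) (y F n κ (r + 1)) (y F n κ (r + 2))) * idem F κ i := by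
  funext α
  have h := toBlock_rel F n κ (Rel.psi_braid (α := α.1) r i h₁ h₂)
  unfold braid at h ⊢
  split_ifs at h ⊢ <;>
    simp only [map_mul, map_add, map_sub, map_neg, map_one, map_zero, map_ofNat] at h <;> exact h

end Relations

/-! ### Lattice paths

A shuffle of two words is encoded by the function `c` for which `c p` is the number of letters of
the first word among the first `p` letters. -/

section Paths

/-- The residue of the `p`-th step of the path `c`. -/
def stepRes (e : ℕ) (c : ℕ → ℕ) (p : ℕ) : ZMod e :=
  if c (p + 1) = c p then (p : ZMod e) - c p else c p

/-- The residue sequence of the path `c`. -/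
def pathSeq (e n : ℕ) (c : ℕ → ℕ) : Fin n → ZMod e := fun t => stepRes e c t

/-- The contribution of the `p`-th step to the degree of the path `c`. -/
def stepDeg (e : ℕ) (c : ℕ → ℕ) (p : ℕ) : ℤ :=
  if c (p + 1) = c p then 0
  else (if (p : ZMod e) = 2 * c p then 1 else 0) - (if (p : ZMod e) = 2 * c p + 1 then 1 else 0)

/-- The degree of the first `N` steps of the path `c`. -/
def pathDeg (e N : ℕ) (c : ℕ → ℕ) : ℤ := ∑ p ∈ Finset.range N, stepDeg e c p

/-- The path `c` with the peak at `q + 1` removed. -/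
def lowerAt (c : ℕ → ℕ) (q : ℕ) : ℕ → ℕ := Function.update c (q + 1) (c q)

/-- The path `c` has a peak at `q + 1`. -/
def Peak (c : ℕ → ℕ) (q : ℕ) : Prop := c (q + 1) = c q + 1 ∧ c (q + 2) = c (q + 1)

/-- `c` is a lattice path that agrees with the initial one from `N` on. -/
structure IsPath (m N : ℕ) (c : ℕ → ℕ) : Prop where
  zero : c 0 = 0
  le_succ : ∀ p, c p ≤ c (p + 1)
  succ_le : ∀ p, c (p + 1) ≤ c p + 1
  tail : ∀ p, N ≤ p → c p = min p m

variable {e n m N : ℕ}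

theorem lowerAt_self (c : ℕ → ℕ) (q : ℕ) : lowerAt c q (q + 1) = c q := by simp [lowerAt]

theorem lowerAt_of_ne (c : ℕ → ℕ) {q p : ℕ} (h : p ≠ q + 1) : lowerAt c q p = c p := by
  simp [lowerAt, h]

theorem isPath_min : IsPath m N (fun p => min p m) where
  zero := by simp
  le_succ p := by omega
  succ_le p := by omega
  tail _ _ := rfl

theorem IsPath.lowerAt {c : ℕ → ℕ} (hc : IsPath m N c) {q : ℕ} (hq : q + 2 ≤ N)
    (h : Peak c q) : IsPath m N (lowerAt c q) := by
  have h₁ := h.1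
  have h₂ : c (q + 1 + 1) = c (q + 1) := h.2
  refine ⟨?_, fun p => ?_, fun p => ?_, fun p hp => ?_⟩
  · rw [lowerAt_of_ne c (by omega), hc.zero]
  · have := hc.le_succ p
    rcases eq_or_ne p (q + 1) with rfl | hp
    · rw [lowerAt_self, lowerAt_of_ne c (by omega)]; omega
    rcases eq_or_ne p q with rfl | hp'
    · rw [lowerAt_self, lowerAt_of_ne c (by omega)]
    rwa [lowerAt_of_ne c hp, lowerAt_of_ne c (by omega)]
  · have := hc.succ_le p
    rcases eq_or_ne p (q + 1) with rfl | hp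
    · rw [lowerAt_self, lowerAt_of_ne c (by omega)]; omega
    rcases eq_or_ne p q with rfl | hp'
    · rw [lowerAt_self, lowerAt_of_ne c (by omega)]; omega
    rwa [lowerAt_of_ne c hp, lowerAt_of_ne c (by omega)]
  · rw [lowerAt_of_ne c (by omega), hc.tail p hp]

theorem nth_pathSeq (c : ℕ → ℕ) (q : ℕ) (hq : q + 1 ≤ n) :
    nth (pathSeq e n c) (q + 1) = stepRes e c q := by
  rw [nth, dif_pos (by omega)]
  rfl

theorem stepRes_peak {c : ℕ → ℕ} {q : ℕ} (h : Peak c q) : stepRes e c q = c q := by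
  rw [stepRes, if_neg (by rw [h.1]; omega)]

theorem stepRes_peak_succ {c : ℕ → ℕ} {q : ℕ} (h : Peak c q) :
    stepRes e c (q + 1) = (q : ZMod e) - c q := by
  rw [stepRes, if_pos h.2, h.1]; push_cast; ring

/-- The residue of an up-step depends only on the number of earlier up-steps, and that of a level
step only on the number of earlier level steps. Lowering a peak exchanges two adjacent steps of
different kinds and changes neither count. -/
theorem stepRes_lowerAt {c : ℕ → ℕ} {q p : ℕ} (h : Peak c q) :
    stepRes e (lowerAt c q) p = stepRes e c (Equiv.swap q (q + 1) p) := by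
  rcases eq_or_ne p q with rfl | hp
  · rw [Equiv.swap_apply_left, stepRes_peak_succ h, stepRes, lowerAt_self,
      lowerAt_of_ne c (by omega), if_pos rfl]
  rcases eq_or_ne p (q + 1) with rfl | hp'
  · rw [Equiv.swap_apply_right, stepRes_peak h, stepRes, lowerAt_self,
      lowerAt_of_ne c (by omega), if_neg (by rw [h.2, h.1]; omega)]
  rw [Equiv.swap_apply_of_ne_of_ne hp hp', stepRes, stepRes, lowerAt_of_ne c (by omega),
    lowerAt_of_ne c (by omega)]

theorem pathSeq_lowerAt {c : ℕ → ℕ} {q : ℕ} (hq : q + 2 ≤ n) (h : Peak c q) :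
    pathSeq e n (lowerAt c q) = swapSeq (q + 1) (pathSeq e n c) := by
  refine seq_ext_nth fun s hs hs' => ?_
  obtain ⟨p, rfl⟩ : ∃ p, s = p + 1 := ⟨s - 1, by omega⟩
  rw [nth_swapSeq _ _ _ hs hs', nth_pathSeq _ _ hs', stepRes_lowerAt h]
  have : Equiv.swap (q + 1) (q + 1 + 1) (p + 1) = Equiv.swap q (q + 1) p + 1 := by
    simp only [Equiv.swap_apply_def]
    split_ifs <;> omega
  rw [this, nth_pathSeq]
  rw [Equiv.swap_apply_def]
  split_ifs <;> omega

/-- This is what `stepDeg` is designed for: the path degree changes exactly by the degree of the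
crossing. Only the up-step that moves from `q` to `q + 1` changes its contribution, and its two
contributions involve the three cases in the Cartan integer. -/
theorem pathDeg_lowerAt {c : ℕ → ℕ} {q : ℕ} (hN : q + 2 ≤ N) (hq : q + 2 ≤ n) (h : Peak c q) :
    pathDeg e N (lowerAt c q) = pathDeg e N c
      - cartan (nth (pathSeq e n c) (q + 1)) (nth (pathSeq e n c) (q + 2)) := by
  rw [nth_pathSeq _ _ (by omega), nth_pathSeq _ _ (by omega), stepRes_peak h, stepRes_peak_succ h]
  rw [eq_sub_iff_add_eq, ← eq_sub_iff_add_eq', pathDeg, pathDeg, ← Finset.sum_sub_distrib,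
    Finset.sum_eq_add (a := q) (b := q + 1) (by omega)]
  · have hp₁ := h.1
    have hp₂ : c (q + 1 + 1) = c (q + 1) := h.2
    have h1 : stepDeg e c (q + 1) = 0 := if_pos h.2
    have h2 : stepDeg e (lowerAt c q) q = 0 := by
      rw [stepDeg, lowerAt_self, lowerAt_of_ne c (by omega), if_pos rfl]
    rw [h1, h2, stepDeg, stepDeg, lowerAt_self, lowerAt_of_ne c (by omega),
      if_neg (show ¬ c (q + 1 + 1) = c q by omega), if_neg (show ¬ c (q + 1) = c q by omega),
      cartan]
    have e1 : ((q + 1 : ℕ) : ZMod e) = 2 * (c q : ZMod e) ↔ (c q : ZMod e) = q - c q + 1 := by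
      push_cast
      constructor <;> intro h <;> linear_combination -h
    have e2 : ((q + 1 : ℕ) : ZMod e) = 2 * (c q : ZMod e) + 1 ↔ (c q : ZMod e) = q - c q := by
      push_cast
      constructor <;> intro h <;> linear_combination -h
    have e3 : (q : ZMod e) = 2 * (c q : ZMod e) ↔ (c q : ZMod e) = q - c q := by
      constructor <;> intro h <;> linear_combination -h
    have e4 : (q : ZMod e) = 2 * (c q : ZMod e) + 1 ↔ (c q : ZMod e) = q - c q - 1 := by
      constructor <;> intro h <;> linear_combination -h
    simp only [e1, e2, e3, e4]
    split_ifs <;> norm_num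
  · intro p _ hp
    rw [stepDeg, stepDeg, lowerAt_of_ne c (by omega), lowerAt_of_ne c (by omega), sub_self]
  · intro hh; exact absurd (Finset.mem_range.2 (by omega)) hh
  · intro hh; exact absurd (Finset.mem_range.2 (by omega)) hh

end Paths

/-! ### Vectors attached to lattice paths -/

section Reach

variable (F : Type*) [Field F] {e : ℕ} [NeZero e] (n : ℕ) (κ : Fin 2 → ZMod e)
variable {M : Type*} [AddCommGroup M] [Module (CycKLR F n κ) M]

/-- `Reach F n κ m N z L c v`: the vector `v` arises from `z` by `L` crossings among the first `N`
strands which turn the initial path into the path `c`. -/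
inductive Reach (m N : ℕ) (z : M) : ℕ → (ℕ → ℕ) → M → Prop
  | base : Reach m N z 0 (fun p => min p m) z
  | step {L : ℕ} {c : ℕ → ℕ} {v : M} (q : ℕ) (hq : q + 2 ≤ N) (h : Peak c q)
      (hv : Reach m N z L c v) : Reach m N z (L + 1) (lowerAt c q) (psi F n κ (q + 1) • v)

variable {F n κ} {m N L : ℕ} {z v : M} {c : ℕ → ℕ}

theorem Reach.isPath (h : Reach F n κ m N z L c v) : IsPath m N c := by
  induction h with
  | base => exact isPath_min
  | step q hq h _ ih => exact ih.lowerAt hq h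

theorem Reach.idem_smul (hN : N ≤ n)
    (hz : idem F κ (pathSeq e n fun p => min p m) • z = z) (h : Reach F n κ m N z L c v) :
    idem F κ (pathSeq e n c) • v = v := by
  induction h with
  | base => exact hz
  | step q hq h _ ih =>
    rw [pathSeq_lowerAt (by omega) h, ← mul_smul, ← psi_mul_idem F n κ _ _ (by omega) (by omega),
      mul_smul, ih]

/-- A valley can only have been created by lowering a peak there, since the initial path has none.
Later crossings that leave the valley intact are not adjacent to it, so they commute with that
crossing, which may be taken to be the last one. -/
theorem Reach.exists_of_valley (h : Reach F n κ m N z L c v) :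
    ∀ q, q + 2 ≤ N → c (q + 1) = c q → c (q + 2) = c (q + 1) + 1 →
      ∃ L' c' v', L = L' + 1 ∧ c = lowerAt c' q ∧ Peak c' q ∧ Reach F n κ m N z L' c' v' ∧
        v = psi F n κ (q + 1) • v' := by
  induction h with
  | base => intro q hq h₁ h₂; simp only at h₁ h₂; omega
  | @step L c v q hq h hv ih =>
    intro t ht h₁ h₂
    rcases eq_or_ne t q with rfl | htq
    · exact ⟨L, c, v, rfl, rfl, h, hv, rfl⟩
    have h3 := h.1
    have h4 : c (q + 1 + 1) = c (q + 1) := h.2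
    have n1 : t ≠ q + 1 := by
      rintro rfl
      rw [lowerAt_self, lowerAt_of_ne c (by omega)] at h₁
      omega
    have n2 : t + 1 ≠ q := by
      rintro rfl
      rw [lowerAt_self, lowerAt_of_ne c (by omega)] at h₂
      omega
    rw [lowerAt_of_ne c (by omega), lowerAt_of_ne c (by omega)] at h₁
    rw [lowerAt_of_ne c (by omega), lowerAt_of_ne c (by omega)] at h₂
    obtain ⟨L', c', v', rfl, rfl, ⟨h5, h6⟩, hv', rfl⟩ := ih t ht h₁ h₂
    rw [lowerAt_of_ne c' (by omega)] at h3
    have h3' : c' (q + 1) = c' q + 1 := by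
      rw [h3, lowerAt_of_ne c' (by omega)]
    have h4' : c' (q + 2) = c' (q + 1) := by
      rwa [lowerAt_of_ne c' (by omega), lowerAt_of_ne c' (by omega)] at h4
    refine ⟨L' + 1, lowerAt c' q, psi F n κ (q + 1) • v', rfl, ?_, ⟨?_, ?_⟩,
      hv'.step q hq ⟨h3', h4'⟩, ?_⟩
    · rw [lowerAt, lowerAt, lowerAt, lowerAt, Function.update_comm (by omega),
        Function.update_of_ne (by omega), Function.update_of_ne (by omega)]
    · rw [lowerAt_of_ne c' (by omega), lowerAt_of_ne c' (by omega), h5]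
    · rw [lowerAt_of_ne c' (by omega), lowerAt_of_ne c' (by omega), h6]
    · rw [← mul_smul, ← mul_smul, psi_mul_psi F n κ _ _ (by omega)]

end Reach

/-! ### Values of the Cartan integers -/

section Cartan

variable {e : ℕ}

theorem cartan_comm (a b : ZMod e) : cartan a b = cartan b a := by
  unfold cartan
  have h₁ : (a = b) ↔ (b = a) := eq_comm
  have h₂ : (a = b + 1) ↔ (b = a - 1) := by rw [eq_sub_iff_add_eq, eq_comm]
  have h₃ : (a = b - 1) ↔ (b = a + 1) := by rw [eq_sub_iff_add_eq, eq_comm]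
  simp only [h₁, h₂, h₃]
  split_ifs <;> rfl

theorem one_ne_zero_zmod (he : 2 ≤ e) : (1 : ZMod e) ≠ 0 := by
  have : Fact (1 < e) := ⟨he⟩
  exact one_ne_zero

theorem two_ne_zero_zmod (he : 2 < e) : (2 : ZMod e) ≠ 0 := by
  intro h
  have h' : ((2 : ℕ) : ZMod e) = 0 := by exact_mod_cast h
  rw [ZMod.natCast_eq_zero_iff] at h'
  exact absurd (Nat.le_of_dvd (by omega) h') (by omega)

theorem cartan_self (he : 2 ≤ e) (a : ZMod e) : cartan a a = 2 := by
  have h := one_ne_zero_zmod he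
  have h₂ : ¬ a = a - 1 := fun hh => h (by linear_combination hh)
  simp [cartan, h, h₂]

theorem cartan_two {a b : ZMod e} (he : e = 2) (h : a ≠ b) : cartan a b = -2 := by
  subst he
  revert a b
  unfold cartan
  decide

theorem cartan_adjacent {a b : ZMod e} (he : 2 < e) (h : a = b + 1) : cartan a b = -1 := by
  subst h
  have h₁ := one_ne_zero_zmod he.le
  have h₂ : ¬ b + 1 = b - 1 := fun hh => two_ne_zero_zmod he (by linear_combination hh)
  simp [cartan, h₁, h₂]

theorem cartan_of_ne {a b : ZMod e} (h : a ≠ b) (h₁ : a ≠ b + 1) (h₂ : a ≠ b - 1) :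
    cartan a b = 0 := by
  simp [cartan, h, h₁, h₂]

end Cartan

/-! ### Homogeneous spans of path vectors, filtered by the number of crossings -/

section Span

variable (F : Type*) [Field F] {e : ℕ} [NeZero e] (n : ℕ) (κ : Fin 2 → ZMod e)
variable {M : Type*} [AddCommGroup M] [Module (CycKLR F n κ) M]

/-- The span of the vectors labelled by paths with residue sequence `i`, degree `d` and fewer
than `K` crossings. -/
def reachSpan (m N : ℕ) (z : M) (i : Fin n → ZMod e) (d : ℤ) (K : ℕ) : AddSubgroup M :=
  AddSubgroup.closure
    {v | ∃ L c, L < K ∧ Reach F n κ m N z L c v ∧ pathSeq e n c = i ∧ pathDeg e N c = d}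

variable {F n κ} {m N L K K' : ℕ} {z u v : M} {c : ℕ → ℕ} {i i' : Fin n → ZMod e} {d d' : ℤ}

theorem reachSpan_mono (h : u ∈ reachSpan F n κ m N z i d K) (hi : i = i') (hd : d = d')
    (hK : K ≤ K') : u ∈ reachSpan F n κ m N z i' d' K' := by
  subst hi hd
  refine AddSubgroup.closure_mono ?_ h
  rintro v ⟨L, c, hL, hv⟩
  exact ⟨L, c, hL.trans_le hK, hv⟩

theorem Reach.mem_reachSpan (h : Reach F n κ m N z L c v) (hK : L < K) :
    v ∈ reachSpan F n κ m N z (pathSeq e n c) (pathDeg e N c) K :=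
  AddSubgroup.subset_closure ⟨L, c, hK, h, rfl, rfl⟩

/-- If no path has the given residues and degree, the generating set of the span is empty. This
turns all vanishing statements into questions about paths. -/
theorem eq_zero_of_mem_reachSpan (h : u ∈ reachSpan F n κ m N z i d K)
    (hc : ∀ c, IsPath m N c → pathSeq e n c = i → pathDeg e N c ≠ d) : u = 0 := by
  induction h using AddSubgroup.closure_induction with
  | mem v hv =>
    obtain ⟨L, c, -, hr, h₁, h₂⟩ := hv
    exact absurd h₂ (hc c hr.isPath h₁)
  | zero => rfl
  | add a b _ _ ha hb => rw [ha, hb, add_zero]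
  | neg a _ ha => rw [ha, neg_zero]

/-- The `y_r`, and the `ψ_r` away from peaks, shorten the vectors with at most `L` crossings, and
they are homogeneous on them. -/
def ActsUpTo (F : Type*) [Field F] {e : ℕ} [NeZero e] (n : ℕ) (κ : Fin 2 → ZMod e)
    {M : Type*} [AddCommGroup M] [Module (CycKLR F n κ) M] (m N : ℕ) (z : M) (L : ℕ) : Prop :=
  ∀ L' c v, L' < L → Reach F n κ m N z L' c v →
    (∀ r, y F n κ r • v ∈ reachSpan F n κ m N z (pathSeq e n c) (pathDeg e N c + 2) L') ∧
    ∀ q, q + 2 ≤ N → ¬ Peak c q → psi F n κ (q + 1) • v ∈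
      reachSpan F n κ m N z (swapSeq (q + 1) (pathSeq e n c)) (pathDeg e N c
        - cartan (nth (pathSeq e n c) (q + 1)) (nth (pathSeq e n c) (q + 2))) L'

theorem ActsUpTo.y_smul_mem (hA : ActsUpTo F n κ m N z L) (hK : K ≤ L)
    (h : u ∈ reachSpan F n κ m N z i d K) (r : ℕ) :
    y F n κ r • u ∈ reachSpan F n κ m N z i (d + 2) (K - 1) := by
  induction h using AddSubgroup.closure_induction with
  | mem v hv =>
    obtain ⟨L', c, hL, hr, rfl, rfl⟩ := hv
    exact reachSpan_mono ((hA L' c v (by omega) hr).1 r) rfl rfl (by omega)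
  | zero => rw [smul_zero]; exact zero_mem _
  | add a b _ _ ha hb => rw [smul_add]; exact add_mem ha hb
  | neg a _ ha => rw [smul_neg]; exact neg_mem ha

/-- At a peak the crossing produces a new path vector, one crossing longer; elsewhere `ActsUpTo`
shortens. Either way the bound grows by at most one. -/
theorem ActsUpTo.psi_smul_mem (hN : N ≤ n) (hA : ActsUpTo F n κ m N z L) (hK : K ≤ L)
    (h : u ∈ reachSpan F n κ m N z i d K) (q : ℕ) (hq : q + 2 ≤ N) :
    psi F n κ (q + 1) • u ∈ reachSpan F n κ m N z (swapSeq (q + 1) i)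
      (d - cartan (nth i (q + 1)) (nth i (q + 2))) (K + 1) := by
  induction h using AddSubgroup.closure_induction with
  | mem v hv =>
    obtain ⟨L', c, hL, hr, rfl, rfl⟩ := hv
    by_cases hp : Peak c q
    · exact reachSpan_mono ((hr.step q hq hp).mem_reachSpan (Nat.lt_succ_self _))
        (pathSeq_lowerAt (by omega) hp) (pathDeg_lowerAt hq (by omega) hp) (by omega)
    · exact reachSpan_mono ((hA L' c v (by omega) hr).2 q hq hp) rfl rfl (by omega)
  | zero => rw [smul_zero]; exact zero_mem _
  | add a b _ _ ha hb => rw [smul_add]; exact add_mem ha hb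
  | neg a _ ha => rw [smul_neg]; exact neg_mem ha

theorem ActsUpTo.quad_smul_mem (he : 2 ≤ e) (hA : ActsUpTo F n κ m N z L) (hK : K ≤ L)
    (h : u ∈ reachSpan F n κ m N z i d K) (a b : ZMod e) (r s : ℕ) :
    quad a b (y F n κ r) (y F n κ s) • u
      ∈ reachSpan F n κ m N z i (d - cartan a b - cartan b a) K := by
  rw [cartan_comm b a]
  unfold quad
  split_ifs with h₁ h₂ h₃ h₄
  · rw [zero_smul]; exact zero_mem _
  · rw [cartan_two h₂ h₁, mul_smul, sub_smul, sub_smul]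
    have key := fun t => hA.y_smul_mem hK h t
    have key2 := hA.y_smul_mem (by omega) (sub_mem (key r) (key s))
    exact reachSpan_mono (sub_mem (key2 s) (key2 r)) rfl (by ring) (by omega)
  · rw [cartan_adjacent (by omega) h₃, sub_smul]
    exact reachSpan_mono (sub_mem (hA.y_smul_mem hK h s) (hA.y_smul_mem hK h r)) rfl (by ring)
      (by omega)
  · rw [cartan_comm, cartan_adjacent (by omega) (show b = a + 1 by rw [h₄]; ring), sub_smul]
    exact reachSpan_mono (sub_mem (hA.y_smul_mem hK h r) (hA.y_smul_mem hK h s)) rfl (by ring)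
      (by omega)
  · rw [cartan_of_ne h₁ h₃ h₄, one_smul]
    exact reachSpan_mono h rfl (by ring) le_rfl

theorem ActsUpTo.braid_smul_mem (he : 2 ≤ e) (hA : ActsUpTo F n κ m N z L) (hK : K ≤ L)
    (h : u ∈ reachSpan F n κ m N z i d K) (r : ℕ) (hr : 1 ≤ r) (hr' : r + 2 ≤ n) :
    braid (nth i r) (nth i (r + 1)) (nth i (r + 2)) (y F n κ r) (y F n κ (r + 1))
      (y F n κ (r + 2)) • u ∈ reachSpan F n κ m N z (swapSeq r (swapSeq (r + 1) (swapSeq r i)))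
        (d - cartan (nth i r) (nth i (r + 1)) - cartan (nth i r) (nth i (r + 2))
          - cartan (nth i (r + 1)) (nth i (r + 2))) K := by
  unfold braid
  split_ifs with h₁ h₂ h₃ h₄
  · rw [swapSeq_braid_eq_self r i hr hr' h₁.1, h₁.1, cartan_self he, cartan_two h₂ h₁.2,
      cartan_two h₂ h₁.2.symm, add_smul, sub_smul, two_mul, add_smul]
    have key := fun t => hA.y_smul_mem hK h t
    exact reachSpan_mono (add_mem (sub_mem (key r) (add_mem (key (r + 1)) (key (r + 1))))
      (key (r + 2))) rfl (by ring) (by omega)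
  · rw [swapSeq_braid_eq_self r i hr hr' h₁.1, h₁.1, cartan_self he,
      cartan_comm (nth i (r + 1)), cartan_adjacent (by omega) h₃, one_smul]
    exact reachSpan_mono h rfl (by ring) le_rfl
  · rw [swapSeq_braid_eq_self r i hr hr' h₁.1, h₁.1, cartan_self he,
      cartan_comm (nth i r) (nth i (r + 1)),
      cartan_adjacent (by omega) (show nth i (r + 1) = nth i r + 1 by rw [h₄]; ring),
      neg_smul, one_smul]
    exact reachSpan_mono (neg_mem h) rfl (by ring) le_rfl
  · rw [zero_smul]; exact zero_mem _
  · rw [zero_smul]; exact zero_mem _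

/-- For one side of the braid relation: once the innermost crossing is known to land in the span
with bound `K`, the two outer ones cost at most two. The remaining work matches the Cartan integers
after each transposition, giving a degree symmetric with that of the other side. -/
theorem ActsUpTo.psi_low_high_smul_mem (hN : N ≤ n) (hA : ActsUpTo F n κ m N z L) (hK : K + 1 ≤ L)
    (q : ℕ) (hq : q + 3 ≤ N)
    (h : psi F n κ (q + 1) • u ∈ reachSpan F n κ m N z (swapSeq (q + 1) i)
      (d - cartan (nth i (q + 1)) (nth i (q + 2))) K) :
    psi F n κ (q + 1) • psi F n κ (q + 2) • psi F n κ (q + 1) • u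
      ∈ reachSpan F n κ m N z (swapSeq (q + 1) (swapSeq (q + 2) (swapSeq (q + 1) i)))
        (d - cartan (nth i (q + 1)) (nth i (q + 2)) - cartan (nth i (q + 1)) (nth i (q + 3))
          - cartan (nth i (q + 2)) (nth i (q + 3))) (K + 2) := by
  have h₂ := hA.psi_smul_mem hN (by omega) h (q + 1) (by omega)
  have h₃ := hA.psi_smul_mem hN hK h₂ q (by omega)
  refine reachSpan_mono h₃ rfl ?_ le_rfl
  rw [show q + 1 + 2 = q + 3 from rfl, show q + 1 + 1 = q + 2 from rfl,
    nth_swapSeq_right (q + 1) i (by omega),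
    nth_swapSeq_of_ne (q + 1) i (q + 3) (by omega) (by omega) (by omega) (by omega),
    nth_swapSeq_of_ne (q + 2) _ (q + 1) (by omega) (by omega) (by omega) (by omega),
    nth_swapSeq_left (q + 2) _ (by omega) (by omega),
    nth_swapSeq_left (q + 1) i (by omega) (by omega),
    nth_swapSeq_of_ne (q + 1) i (q + 3) (by omega) (by omega) (by omega) (by omega)]

theorem ActsUpTo.psi_high_low_smul_mem (hN : N ≤ n) (hA : ActsUpTo F n κ m N z L) (hK : K + 1 ≤ L)
    (q : ℕ) (hq : q + 3 ≤ N)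
    (h : psi F n κ (q + 2) • u ∈ reachSpan F n κ m N z (swapSeq (q + 2) i)
      (d - cartan (nth i (q + 2)) (nth i (q + 3))) K) :
    psi F n κ (q + 2) • psi F n κ (q + 1) • psi F n κ (q + 2) • u
      ∈ reachSpan F n κ m N z (swapSeq (q + 1) (swapSeq (q + 2) (swapSeq (q + 1) i)))
        (d - cartan (nth i (q + 1)) (nth i (q + 2)) - cartan (nth i (q + 1)) (nth i (q + 3))
          - cartan (nth i (q + 2)) (nth i (q + 3))) (K + 2) := by
  have h₂ := hA.psi_smul_mem hN (by omega) h q (by omega)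
  have h₃ := hA.psi_smul_mem hN hK h₂ (q + 1) (by omega)
  refine reachSpan_mono h₃ (swapSeq_braid (q + 1) i (by omega) (by omega)).symm ?_ le_rfl
  rw [show q + 1 + 2 = q + 3 from rfl, show q + 1 + 1 = q + 2 from rfl,
    nth_swapSeq_left (q + 2) i (by omega) (by omega),
    nth_swapSeq_of_ne (q + 2) i (q + 1) (by omega) (by omega) (by omega) (by omega),
    nth_swapSeq_of_ne (q + 1) _ (q + 3) (by omega) (by omega) (by omega) (by omega),
    nth_swapSeq_right (q + 1) _ (by omega),
    nth_swapSeq_right (q + 2) i (by omega),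
    nth_swapSeq_of_ne (q + 2) i (q + 1) (by omega) (by omega) (by omega) (by omega)]
  ring

end Span

/-! ### Generators away from peaks shorten path vectors -/

section Action

variable {F : Type*} [Field F] {e : ℕ} [NeZero e] {n : ℕ} {κ : Fin 2 → ZMod e}
variable {M : Type*} [AddCommGroup M] [Module (CycKLR F n κ) M]
variable {m N : ℕ} {z : M}

theorem braid_smul_of_idem_smul {u : M} {i : Fin n → ZMod e} (hu : idem F κ i • u = u) (r : ℕ)
    (h₁ : 1 ≤ r) (h₂ : r + 2 ≤ n) :
    psi F n κ r • psi F n κ (r + 1) • psi F n κ r • u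
      = psi F n κ (r + 1) • psi F n κ r • psi F n κ (r + 1) • u
        + braid (nth i r) (nth i (r + 1)) (nth i (r + 2))
            (y F n κ r) (y F n κ (r + 1)) (y F n κ (r + 2)) • u := by
  have h := congrArg (· • u) (psi_braid_mul_idem F n κ r i h₁ h₂)
  simpa only [mul_smul, add_smul, hu] using h

/-- Moving `y` past the last crossing yields `ψ` applied to a shortened vector, plus possibly the
uncrossed vector `v`. That error term occurs only for equal residues, where the crossing has degree
`-2`, so `v` has the required degree and residue sequence. -/
theorem Reach.y_smul_mem_of_actsUpTo (he : 2 ≤ e) (hN : N ≤ n)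
    (hz : idem F κ (pathSeq e n fun p => min p m) • z = z) {L : ℕ}
    (hA : ActsUpTo F n κ m N z (L + 1)) {c : ℕ → ℕ} {v : M} (hv : Reach F n κ m N z L c v)
    (t : ℕ) (ht : t + 2 ≤ N) (hp : Peak c t) (r : ℕ) :
    y F n κ r • psi F n κ (t + 1) • v ∈ reachSpan F n κ m N z (pathSeq e n (lowerAt c t))
      (pathDeg e N (lowerAt c t) + 2) (L + 1) := by
  have hi := hv.idem_smul hN hz
  have hy := fun s => (hA L c v (by omega) hv).1 s
  have hmem : ∀ s, psi F n κ (t + 1) • y F n κ s • v ∈ reachSpan F n κ m N z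
      (pathSeq e n (lowerAt c t)) (pathDeg e N (lowerAt c t) + 2) (L + 1) := fun s =>
    reachSpan_mono (hA.psi_smul_mem hN (by omega) (hy s) t ht) (pathSeq_lowerAt (by omega) hp).symm
      (by rw [pathDeg_lowerAt (n := n) ht (by omega) hp]; ring) le_rfl
  have hmem' : (if nth (pathSeq e n c) (t + 1) = nth (pathSeq e n c) (t + 2)
        then (1 : CycKLR F n κ) else 0) • v ∈ reachSpan F n κ m N z
      (pathSeq e n (lowerAt c t)) (pathDeg e N (lowerAt c t) + 2) (L + 1) := by
    split_ifs with h
    · rw [one_smul]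
      refine reachSpan_mono (hv.mem_reachSpan (Nat.lt_succ_self L)) ?_ ?_ le_rfl
      · rw [pathSeq_lowerAt (by omega) hp, swapSeq_eq_self _ _ (by omega) (by omega) h]
      · rw [pathDeg_lowerAt (n := n) ht (by omega) hp, h, cartan_self he]; ring
    · rw [zero_smul]; exact zero_mem _
  rcases eq_or_ne r (t + 1) with rfl | h₁
  · have h := congrArg (· • v)
      (y_mul_psi_mul_idem F n κ (t + 1) (pathSeq e n c) (by omega) (by omega))
    simp only [mul_smul, hi, sub_smul] at h
    rw [h]
    exact sub_mem (hmem _) hmem'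
  rcases eq_or_ne r (t + 2) with rfl | h₂
  · have h := congrArg (· • v)
      (y_succ_mul_psi_mul_idem F n κ (t + 1) (pathSeq e n c) (by omega) (by omega))
    simp only [mul_smul, hi, add_smul] at h
    rw [h]
    exact add_mem (hmem _) hmem'
  · rw [← mul_smul, ← psi_mul_y F n κ _ _ h₁ h₂, mul_smul]
    exact hmem r

/-- The cases follow the position of the new crossing relative to the last one: equal positions use
the quadratic relation, neighbouring positions the braid relation, and distant ones commute. -/
theorem Reach.psi_smul_mem_of_actsUpTo (he : 2 ≤ e) (hN : N ≤ n)
    (hz : idem F κ (pathSeq e n fun p => min p m) • z = z) {L : ℕ}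
    (hA : ActsUpTo F n κ m N z (L + 1)) {c : ℕ → ℕ} {v : M} (hv : Reach F n κ m N z L c v)
    (t : ℕ) (ht : t + 2 ≤ N) (hp : Peak c t) (q : ℕ) (hq : q + 2 ≤ N)
    (hnp : ¬ Peak (lowerAt c t) q) :
    psi F n κ (q + 1) • psi F n κ (t + 1) • v ∈
      reachSpan F n κ m N z (swapSeq (q + 1) (pathSeq e n (lowerAt c t)))
        (pathDeg e N (lowerAt c t) - cartan (nth (pathSeq e n (lowerAt c t)) (q + 1))
          (nth (pathSeq e n (lowerAt c t)) (q + 2))) (L + 1) := by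
  have hi := hv.idem_smul hN hz
  have hv' := hv.mem_reachSpan (Nat.lt_succ_self L)
  have hpath := (hv.step t ht hp).isPath
  have hp₁ := hp.1
  have hp₂ := hp.2
  rcases eq_or_ne q t with rfl | hqt
  · have h := congrArg (· • v)
      (psi_mul_psi_mul_idem F n κ (q + 1) (pathSeq e n c) (by omega) (by omega))
    simp only [mul_smul, hi] at h
    rw [h]
    refine reachSpan_mono (hA.quad_smul_mem he le_rfl hv' _ _ _ _) ?_ ?_ le_rfl
    · rw [pathSeq_lowerAt (by omega) hp, swapSeq_swapSeq _ _ (by omega) (by omega)]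
    · rw [pathSeq_lowerAt (by omega) hp, nth_swapSeq_left _ _ (by omega) (by omega),
        nth_swapSeq_right _ _ (by omega), pathDeg_lowerAt (n := n) hq (by omega) hp]
  rcases eq_or_ne q (t + 1) with rfl | hqt₁
  -- The lowered path climbs at step `t + 1`; having no peak there, it climbs again. Thus `c` has a
  -- valley around `t + 2`, and the vector ends in a crossing to which the braid relation applies.
  · have h₃ : c (t + 3) = c (t + 2) + 1 := by
      have h₁ := hpath.le_succ (t + 2)
      have h₂ := hpath.succ_le (t + 2)
      by_contra hne
      refine hnp ⟨?_, ?_⟩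
      · rw [lowerAt_self, lowerAt_of_ne c (by omega), hp₂, hp₁]
      · change lowerAt c t (t + 3) = lowerAt c t (t + 2)
        rw [lowerAt_of_ne c (by omega), lowerAt_of_ne c (by omega)] at h₁ h₂ ⊢
        change c (t + 2) ≤ c (t + 3) at h₁
        change c (t + 3) ≤ c (t + 2) + 1 at h₂
        omega
    obtain ⟨L', c', v', rfl, rfl, hp', hv'', rfl⟩ := hv.exists_of_valley (t + 1) hq hp₂ h₃
    have hi' := hv''.idem_smul hN hz
    have hb := braid_smul_of_idem_smul hi' (t + 1) (by omega) (by omega)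
    rw [← sub_eq_iff_eq_add] at hb
    rw [show t + 1 + 1 = t + 2 from rfl] at hb ⊢
    rw [← hb]
    -- Before the valley was cut, the path climbed twice in a row from `t`. So the innermost
    -- crossing after braiding meets no peak and shortens the vector, which compensates for the two
    -- outer crossings.
    have hnp' : ¬ Peak c' t := by
      rintro ⟨h₁, h₂⟩
      have := hp'.1
      rw [show t + 1 + 1 = t + 2 from rfl] at this
      omega
    have hlow := (hA L' c' v' (by omega) hv'').2 t ht hnp'
    have k₁ := hA.psi_low_high_smul_mem hN (by omega) t (by omega) hlow
    have k₂ := hA.braid_smul_mem he (by omega) (hv''.mem_reachSpan (Nat.lt_succ_self L'))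
      (t + 1) (by omega) (by omega)
    refine reachSpan_mono (sub_mem k₁ (reachSpan_mono k₂ rfl rfl (by omega))) ?_ ?_ le_rfl
    · rw [pathSeq_lowerAt (by omega) hp, pathSeq_lowerAt (by omega) hp']
      exact swapSeq_braid (t + 1) _ (by omega) (by omega)
    · rw [pathDeg_lowerAt (n := n) ht (by omega) hp, pathDeg_lowerAt (n := n) hq (by omega) hp',
        pathSeq_lowerAt (by omega) hp, pathSeq_lowerAt (by omega) hp',
        show t + 1 + 2 = t + 3 from rfl, show t + 1 + 1 = t + 2 from rfl,
        nth_swapSeq_left (t + 2) _ (by omega) (by omega),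
        nth_swapSeq_of_ne (t + 2) _ (t + 1) (by omega) (by omega) (by omega) (by omega),
        nth_swapSeq_of_ne (t + 1) _ (t + 3) (by omega) (by omega) (by omega) (by omega),
        nth_swapSeq_right (t + 1) _ (by omega),
        nth_swapSeq_right (t + 2) _ (by omega),
        nth_swapSeq_of_ne (t + 2) _ (t + 1) (by omega) (by omega) (by omega) (by omega)]
      ring
  rcases eq_or_ne (q + 1) t with rfl | hqt₂
  -- The reflected situation: the lowered path is level at step `q + 1`, so the absence of a peak
  -- forces a level step at `q` too, and `c` has a valley around `q + 1`.
  · have h₃ : c (q + 1) = c q := by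
      have h₁ := hpath.le_succ q
      have h₂ := hpath.succ_le q
      rw [lowerAt_of_ne c (by omega), lowerAt_of_ne c (by omega)] at h₁ h₂
      by_contra hne
      refine hnp ⟨?_, ?_⟩
      · rw [lowerAt_of_ne c (by omega), lowerAt_of_ne c (by omega)]
        omega
      · rw [lowerAt_self, lowerAt_of_ne c (by omega)]
    obtain ⟨L', c', v', rfl, rfl, hp', hv'', rfl⟩ := hv.exists_of_valley q hq h₃ hp₁
    have hi' := hv''.idem_smul hN hz
    have hb := braid_smul_of_idem_smul hi' (q + 1) (by omega) (by omega)
    rw [hb]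
    have hnp' : ¬ Peak c' (q + 1) := by
      rintro ⟨h₁, h₂⟩
      have := hp'.2
      rw [show q + 1 + 1 = q + 2 from rfl] at h₁
      omega
    have hlow := (hA L' c' v' (by omega) hv'').2 (q + 1) ht hnp'
    have k₁ := hA.psi_high_low_smul_mem hN (by omega) q (by omega) hlow
    have k₂ := hA.braid_smul_mem he (by omega) (hv''.mem_reachSpan (Nat.lt_succ_self L'))
      (q + 1) (by omega) (by omega)
    refine reachSpan_mono (add_mem k₁ (reachSpan_mono k₂ rfl rfl (by omega))) ?_ ?_ le_rfl
    · rw [pathSeq_lowerAt (by omega) hp, pathSeq_lowerAt (by omega) hp']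
    · rw [pathDeg_lowerAt (n := n) ht (by omega) hp, pathDeg_lowerAt (n := n) hq (by omega) hp',
        pathSeq_lowerAt (by omega) hp, pathSeq_lowerAt (by omega) hp',
        show q + 1 + 2 = q + 3 from rfl, show q + 1 + 1 = q + 2 from rfl,
        nth_swapSeq_of_ne (q + 2) _ (q + 1) (by omega) (by omega) (by omega) (by omega),
        nth_swapSeq_left (q + 2) _ (by omega) (by omega),
        nth_swapSeq_right (q + 1) _ (by omega),
        nth_swapSeq_left (q + 1) _ (by omega) (by omega),
        nth_swapSeq_of_ne (q + 1) _ (q + 3) (by omega) (by omega) (by omega) (by omega)]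
  · have hnp' : ¬ Peak c q := by
      rintro ⟨h₁, h₂⟩
      refine hnp ⟨?_, ?_⟩
      · rwa [lowerAt_of_ne c (by omega), lowerAt_of_ne c (by omega)]
      · rwa [lowerAt_of_ne c (by omega), lowerAt_of_ne c (by omega)]
    rw [← mul_smul, psi_mul_psi F n κ _ _ (by omega), mul_smul]
    have hlow := (hA L c v (by omega) hv).2 q hq hnp'
    refine reachSpan_mono (hA.psi_smul_mem hN (by omega) hlow t ht) ?_ ?_ le_rfl
    · rw [pathSeq_lowerAt (by omega) hp,
        swapSeq_comm _ _ _ (by omega) (by omega) (by omega) (by omega) (by omega)]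
    · rw [pathDeg_lowerAt (n := n) ht (by omega) hp, pathSeq_lowerAt (by omega) hp,
        nth_swapSeq_of_ne (t + 1) _ (q + 1) (by omega) (by omega) (by omega) (by omega),
        nth_swapSeq_of_ne (t + 1) _ (q + 2) (by omega) (by omega) (by omega) (by omega),
        nth_swapSeq_of_ne (q + 1) _ (t + 1) (by omega) (by omega) (by omega) (by omega),
        nth_swapSeq_of_ne (q + 1) _ (t + 2) (by omega) (by omega) (by omega) (by omega)]
      ring

/-- Induction on the number of crossings. The initial path has its only peak at `m`, so the base
case consists precisely of the defining relations of `z`; the missing relation at `m` is the one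
never asked for. -/
theorem actsUpTo (he : 2 ≤ e) (hN : N ≤ n)
    (hz : idem F κ (pathSeq e n fun p => min p m) • z = z) (hy : ∀ r, y F n κ r • z = 0)
    (hpsi : ∀ q, q + 2 ≤ N → q + 1 ≠ m → psi F n κ (q + 1) • z = 0) (L : ℕ) :
    ActsUpTo F n κ m N z L := by
  induction L with
  | zero => intro L' c v hL; omega
  | succ L ih =>
    intro L' c v hL hv
    rcases Nat.lt_succ_iff_lt_or_eq.1 hL with h | rfl
    · exact ih L' c v h hv
    cases hv with
    | base =>
      refine ⟨fun r => ?_, fun q hq hp => ?_⟩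
      · rw [hy]; exact zero_mem _
      · rw [hpsi q hq]
        · exact zero_mem _
        · rintro rfl
          exact hp ⟨by simp, by simp⟩
    | step t ht hp hv =>
      exact ⟨fun r => hv.y_smul_mem_of_actsUpTo he hN hz ih t ht hp r,
        fun q hq hnp => hv.psi_smul_mem_of_actsUpTo he hN hz ih t ht hp q hq hnp⟩

end Action

/-! ### Standard tableaux as lattice paths -/

section Tableau

variable {F : Type*} [Field F] {e : ℕ} [NeZero e] {n : ℕ} {κ : Fin 2 → ZMod e}
variable {M : Type*} [AddCommGroup M] [Module (CycKLR F n κ) M]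
variable {m N : ℕ} {z : M}

/-- The path whose `s`-th up-step ends at `a s`. -/
structure PathOf (m N : ℕ) (a c : ℕ → ℕ) : Prop where
  le_iff : ∀ s p, 1 ≤ s → s ≤ m → (s ≤ c p ↔ a s ≤ p)
  le : ∀ p, c p ≤ m
  self_le : ∀ s, 1 ≤ s → s ≤ m → s ≤ a s
  lt_succ : ∀ s, 1 ≤ s → s < m → a s < a (s + 1)
  le_bound : ∀ s, 1 ≤ s → s ≤ m → a s ≤ N

/-- One factor of `psiTab` delays a single up-step, namely number `s + 1`, by one place per
crossing. The later up-steps are already in their final position, so each crossing takes place at a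
peak. -/
theorem PathOf.reach_column {a c : ℕ → ℕ} (h : PathOf m N a c) {s : ℕ} (hs : s < m) {L : ℕ} {v : M}
    (hv : Reach F n κ m N z L (fun p => max (min p (s + 1)) (c p)) v) (l : ℕ)
    (hl : s + 1 + l ≤ a (s + 1)) :
    ∃ L', Reach F n κ m N z L'
      (fun p => max (max (min p s) (c p)) (if s + 1 + l ≤ p then s + 1 else 0))
      (((List.range' (s + 1) l).reverse.map (psi F n κ)).prod • v) := by
  induction l with
  | zero =>
    refine ⟨L, ?_⟩
    have : (fun p => max (max (min p s) (c p)) (if s + 1 + 0 ≤ p then s + 1 else 0))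
        = fun p => max (min p (s + 1)) (c p) := by
      funext p
      split_ifs <;> omega
    rw [this]
    simpa using hv
  | succ l ih =>
    obtain ⟨L', hL⟩ := ih (by omega)
    have c₀ : c (s + l) ≤ s := by
      have := (h.le_iff (s + 1) (s + l) (by omega) hs).1
      omega
    have c₁ : c (s + l + 1) ≤ s := by
      have := (h.le_iff (s + 1) (s + l + 1) (by omega) hs).1
      omega
    -- The next up-step ends after `a (s + 1)`, which leaves room for a level step behind the one
    -- being delayed.
    have c₂ : c (s + l + 2) ≤ s + 1 := by
      by_contra hc
      have h₀ := h.le (s + l + 2)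
      have h₁ := (h.le_iff (s + 1 + 1) (s + l + 2) (by omega) (by omega)).1 (by omega)
      have h₂ := h.lt_succ (s + 1) (by omega) (by omega)
      omega
    have hb := h.le_bound (s + 1) (by omega) hs
    have hstep := hL.step (s + l) (by omega) ⟨by split_ifs <;> omega, by split_ifs <;> omega⟩
    refine ⟨L' + 1, ?_⟩
    rw [List.range'_concat, List.reverse_append, List.map_append, List.prod_append, mul_smul]
    simp only [List.reverse_cons, List.reverse_nil, List.nil_append, List.map_cons, List.map_nil,
      List.prod_cons, List.prod_nil, mul_one, one_mul]
    rw [show s + 1 + l = s + l + 1 by omega]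
    convert hstep using 1
    funext p
    rcases eq_or_ne p (s + l + 1) with rfl | hp
    · rw [lowerAt_self]
      split_ifs <;> omega
    · rw [lowerAt_of_ne _ hp]
      split_ifs <;> omega

/-- The rightmost factor acts first, so the up-steps are put in place from the last to the first. In
the intermediate path the first `s` up-steps are still initial and the others are those of `c`. -/
theorem PathOf.reach_tail {a c : ℕ → ℕ} (h : PathOf m N a c) (t s : ℕ) (hs : s + t = m) :
    ∃ L, Reach F n κ m N z L (fun p => max (min p s) (c p))
      (((List.range' s t).map fun s => psiDown F κ n (a (s + 1) - 1) (s + 1)).prod • z) := by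
  induction t generalizing s with
  | zero =>
    refine ⟨0, ?_⟩
    have : (fun p => max (min p s) (c p)) = fun p => min p m := by
      funext p
      have h₁ := h.le p
      have h₂ := h.le_iff (c p) p
      have h₃ := h.self_le (c p)
      omega
    rw [this]
    simpa using Reach.base
  | succ t ih =>
    obtain ⟨L, hL⟩ := ih (s + 1) (by omega)
    have hsa := h.self_le (s + 1) (by omega) (by omega)
    obtain ⟨L', hL'⟩ := h.reach_column (by omega) hL (a (s + 1) - (s + 1)) (by omega)
    refine ⟨L', ?_⟩
    rw [List.range'_succ, List.map_cons, List.prod_cons, mul_smul, psiDown,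
      show a (s + 1) - 1 + 1 - (s + 1) = a (s + 1) - (s + 1) by omega]
    convert hL' using 1
    funext p
    have := h.le_iff (s + 1) p (by omega) (by omega)
    split_ifs <;> omega

theorem PathOf.reach_psiTab {a c : ℕ → ℕ} (h : PathOf m N a c) :
    ∃ L, Reach F n κ m N z L c (psiTab F κ n m a • z) := by
  obtain ⟨L, hL⟩ := h.reach_tail (F := F) (n := n) (κ := κ) (z := z) m 0 (by omega)
  refine ⟨L, ?_⟩
  rw [psiTab, List.range_eq_range']
  simpa using hL

end Tableau

/-! ### Degrees of paths -/

section Degrees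

variable {e m N : ℕ}

/-- The path of the tableau with entries `1, …, e - 1, e + 1, e + 3, …` in its second component. -/
def gammaPath (e m p : ℕ) : ℕ := min (min p ((p + e - 1) / 2)) m

theorem pathOf_gammaEntry (he : 2 ≤ e) (hm : e ≤ m) :
    PathOf m (2 * m - e + 2) (gammaEntry e) (gammaPath e m) where
  le_iff s p h₁ h₂ := by
    unfold gammaEntry gammaPath
    split_ifs <;> omega
  le p := by unfold gammaPath; omega
  self_le s h₁ h₂ := by
    unfold gammaEntry
    split_ifs <;> omega
  lt_succ s h₁ h₂ := by
    unfold gammaEntry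
    split_ifs <;> omega
  le_bound s h₁ h₂ := by
    unfold gammaEntry
    split_ifs <;> omega

theorem natCast_zmod_ne_zero {a : ℕ} (h₁ : 0 < a) (h₂ : a < e) : (a : ZMod e) ≠ 0 := by
  rw [Ne, ZMod.natCast_eq_zero_iff]
  exact fun h => absurd (Nat.le_of_dvd h₁ h) (by omega)

theorem pathDeg_succ (N : ℕ) (c : ℕ → ℕ) :
    pathDeg e (N + 1) c = pathDeg e N c + stepDeg e c N := Finset.sum_range_succ _ _

theorem pathDeg_congr {c c' : ℕ → ℕ} (h : ∀ p ≤ N, c p = c' p) :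
    pathDeg e N c = pathDeg e N c' := by
  refine Finset.sum_congr rfl fun p hp => ?_
  have hp' := Finset.mem_range.1 hp
  rw [stepDeg, stepDeg, h p (by omega), h (p + 1) (by omega)]

/-- A climb at a height divisible by `e` contributes `1`, and the climb reaching the next multiple
of `e` contributes `-1`. Since `e ∣ m` these cancel. -/
theorem pathDeg_initial (hm : e ∣ m) (hN : m ≤ N) :
    pathDeg e N (fun p => min p m) = 0 := by
  have key : ∀ P, pathDeg e P (fun p => min p m)
      = 1 - if ((min P m : ℕ) : ZMod e) = 0 then 1 else 0 := by
    intro P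
    induction P with
    | zero => simp [pathDeg]
    | succ P ih =>
      rw [pathDeg_succ, ih, stepDeg]
      rcases lt_or_ge P m with h | h
      · rw [min_eq_left (show P + 1 ≤ m from h), min_eq_left h.le,
          if_neg (show ¬ P + 1 = P by omega)]
        have h₁ : (P : ZMod e) = 2 * (P : ZMod e) ↔ (P : ZMod e) = 0 := by
          constructor <;> intro h <;> linear_combination -h
        have h₂ : (P : ZMod e) = 2 * (P : ZMod e) + 1 ↔ ((P + 1 : ℕ) : ZMod e) = 0 := by
          push_cast
          constructor <;> intro h <;> linear_combination -h
        simp only [h₁, h₂]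
        ring
      · rw [min_eq_right h, min_eq_right (h.trans (Nat.le_succ P)), if_pos rfl, add_zero]
  rw [key, min_eq_right hN, if_pos ((ZMod.natCast_eq_zero_iff m e).2 hm), sub_self]

theorem stepDeg_two {c : ℕ → ℕ} {p : ℕ} : stepDeg 2 c p =
    if c (p + 1) = c p then 0 else if p % 2 = 0 then 1 else -1 := by
  have h2 : (2 : ZMod 2) = 0 := rfl
  have h₁ : (p : ZMod 2) = 0 ↔ p % 2 = 0 := by
    rw [ZMod.natCast_eq_zero_iff]; omega
  have h₂ : (p : ZMod 2) = 1 ↔ p % 2 = 1 := by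
    rw [show (1 : ZMod 2) = ((1 : ℕ) : ZMod 2) by simp, ZMod.natCast_eq_natCast_iff]
    simp [Nat.ModEq]
  rw [stepDeg, h2, zero_mul, zero_add]
  simp only [h₁, h₂]
  split_ifs <;> first | rfl | omega

/-- For `e = 2` an up-step contributes `1` at even positions and `-1` at odd ones, so the degree
reaches the height exactly when all odd steps are level. -/
theorem IsPath.pathDeg_two_le {c : ℕ → ℕ} (hc : IsPath m N c) (P : ℕ) :
    pathDeg 2 P c ≤ c P ∧ (pathDeg 2 P c = c P → ∀ p < P, p % 2 = 1 → c (p + 1) = c p) := by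
  induction P with
  | zero => simp [pathDeg, hc.zero]
  | succ P ih =>
    have h₁ := hc.le_succ P
    have h₂ := hc.succ_le P
    rw [pathDeg_succ, stepDeg_two]
    refine ⟨by split_ifs <;> omega, fun h p hp hp' => ?_⟩
    rcases Nat.lt_succ_iff_lt_or_eq.1 hp with hp | rfl
    · exact ih.2 (by split_ifs at h <;> omega) p hp hp'
    · split_ifs at h <;> omega

/-- For `e = 2` a path of maximal degree is unique. -/
theorem IsPath.eq_of_pathDeg_two {c : ℕ → ℕ} (hc : IsPath m (2 * m) c)
    (h : pathDeg 2 (2 * m) c = m) (p : ℕ) (hp : p ≤ 2 * m) : c p = (p + 1) / 2 := by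
  have htail : c (2 * m) = m := by rw [hc.tail _ le_rfl]; omega
  have hodd := (hc.pathDeg_two_le (2 * m)).2 (by rw [h, htail])
  have hstep : ∀ k, k < m → c (2 * k + 2) = c (2 * k + 1) ∧ c (2 * k + 1) ≤ c (2 * k) + 1 :=
    fun k hk => ⟨hodd (2 * k + 1) (by omega) (by omega), hc.succ_le (2 * k)⟩
  -- Every pair of steps climbs at most once. Since the endpoint `m` is reached after `m` pairs,
  -- each pair climbs exactly once; this is squeezed out from both ends.
  have hup : ∀ k, k ≤ m → c (2 * k) ≤ k := by
    intro k hk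
    induction k with
    | zero => simp [hc.zero]
    | succ k ih =>
      have := hstep k (by omega)
      have := ih (by omega)
      rw [show 2 * (k + 1) = 2 * k + 2 by ring]
      omega
  have hdown : ∀ l, l ≤ m → m - l ≤ c (2 * (m - l)) := by
    intro l hl
    induction l with
    | zero => simp [htail]
    | succ l ih =>
      have h₁ := hstep (m - (l + 1)) (by omega)
      have h₂ := ih (by omega)
      rw [show 2 * (m - l) = 2 * (m - (l + 1)) + 2 by omega] at h₂
      omega
  have heven : ∀ k, k ≤ m → c (2 * k) = k := by
    intro k hk
    have h₁ := hup k hk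
    have h₂ := hdown (m - k) (by omega)
    rw [show m - (m - k) = k by omega] at h₂
    omega
  rcases Nat.even_or_odd' p with ⟨k, rfl | rfl⟩
  · rw [heven k (by omega)]; omega
  · have h₁ := hstep k (by omega)
    have h₂ := heven (k + 1) (by omega)
    rw [show 2 * (k + 1) = 2 * k + 2 by ring] at h₂
    omega

/-- For `e > 2` only the very first up-step contributes. For `e = 2` all `m` up-steps start at even
positions and contribute `1` each. -/
theorem pathDeg_gammaPath (he : 2 ≤ e) (hm : e ≤ m) :
    pathDeg e (2 * m - e + 2) (gammaPath e m) = 1 + if e = 2 then (m : ℤ) - 1 else 0 := by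
  split_ifs with h
  · subst h
    have key : ∀ P, P ≤ 2 * m → pathDeg 2 P (gammaPath 2 m) = gammaPath 2 m P := by
      intro P hP
      induction P with
      | zero => simp [pathDeg, gammaPath]
      | succ P ih =>
        rw [pathDeg_succ, stepDeg_two, ih (by omega)]
        unfold gammaPath
        split_ifs <;> omega
    rw [key _ (by omega), gammaPath]
    omega
  · have key : ∀ p ∈ Finset.range (2 * m - e + 2),
        stepDeg e (gammaPath e m) p = if p = 0 then 1 else 0 := by
      intro p hp
      have hp' := Finset.mem_range.1 hp
      have h1 := natCast_zmod_ne_zero (e := e) (a := 1) (by omega) (by omega)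
      have h2 := natCast_zmod_ne_zero (e := e) (a := 2) (by omega) (by omega)
      rcases lt_or_ge p (e - 1) with h₁ | h₁
      · have g : gammaPath e m p = p := by unfold gammaPath; omega
        have g' : gammaPath e m (p + 1) = p + 1 := by unfold gammaPath; omega
        have h₃ : ¬ (p : ZMod e) = 2 * (p : ZMod e) + 1 := by
          intro hh
          refine natCast_zmod_ne_zero (e := e) (a := p + 1) (by omega) (by omega) ?_
          push_cast
          linear_combination -hh
        rw [stepDeg, g, g', if_neg (by omega), if_neg h₃, sub_zero]
        refine if_congr ⟨fun hh => ?_, fun hh => by simp [hh]⟩ rfl rfl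
        by_contra h0
        refine natCast_zmod_ne_zero (e := e) (a := p) (by omega) (by omega) ?_
        linear_combination -hh
      rw [if_neg (show p ≠ 0 by omega)]
      by_cases h₂ : gammaPath e m (p + 1) = gammaPath e m p
      · rw [stepDeg, if_pos h₂]
      -- In the zigzag part every up-step starts with `p - 2c ≡ 2` modulo `e`, which is neither `0`
      -- nor `1` when `e > 2`.
      · have g : 2 * gammaPath e m p = p + e - 2 := by unfold gammaPath at h₂ ⊢; omega
        have g' : (2 : ZMod e) * (gammaPath e m p : ZMod e) = p - 2 := by
          have : ((2 * gammaPath e m p + 2 : ℕ) : ZMod e) = ((p + e : ℕ) : ZMod e) := by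
            congr 1; omega
          push_cast [ZMod.natCast_self] at this
          linear_combination this
        rw [stepDeg, if_neg h₂, g', if_neg, if_neg, sub_zero]
        · intro hh
          apply h1
          push_cast
          linear_combination hh
        · intro hh
          apply h2
          push_cast
          linear_combination hh
    rw [pathDeg, Finset.sum_congr rfl key, Finset.sum_ite_eq', if_pos (by simp), add_zero]

end Degrees

/-! ### How far residues determine a path -/

section Following

variable {e n m N : ℕ}

theorem IsPath.stepRes_cases {c : ℕ → ℕ} (hc : IsPath m N c) (p : ℕ) :
    (c (p + 1) = c p + 1 ∧ stepRes e c p = c p) ∨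
      (c (p + 1) = c p ∧ stepRes e c p = (p : ZMod e) - c p) := by
  have h₁ := hc.le_succ p
  have h₂ := hc.succ_le p
  by_cases h : c (p + 1) = c p
  · exact Or.inr ⟨h, if_pos h⟩
  · exact Or.inl ⟨by omega, if_neg h⟩

theorem IsPath.le_self {c : ℕ → ℕ} (hc : IsPath m N c) (p : ℕ) : c p ≤ p := by
  induction p with
  | zero => rw [hc.zero]
  | succ p ih => have := hc.succ_le p; omega

/-- A path whose residues agree with those of a path `T` moves parallel to it as long as the two
residues available to `T` differ. -/
theorem IsPath.follow {c T : ℕ → ℕ} (hc : IsPath m N c)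
    (hT : ∀ p, T (p + 1) = T p ∨ T (p + 1) = T p + 1) {p₀ P : ℕ}
    (hres : ∀ p, p₀ ≤ p → p < P → stepRes e c p = stepRes e T p)
    (hD : ∀ p, p₀ ≤ p → p < P → (p : ZMod e) ≠ 2 * T p) (h₀ : (c p₀ : ZMod e) = T p₀) (p : ℕ)
    (hp : p₀ ≤ p) (hP : p ≤ P) : c p + T p₀ = c p₀ + T p := by
  induction p, hp using Nat.le_induction with
  | base => rfl
  | succ p hp ih =>
    have ih := ih (by omega)
    have hcast : (c p : ZMod e) = T p := by
      have := congrArg (Nat.cast (R := ZMod e)) ih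
      push_cast at this
      rw [h₀] at this
      linear_combination this
    have hr := hres p hp (by omega)
    have hd := hD p hp (by omega)
    have hT' : stepRes e T p = if T (p + 1) = T p then (p : ZMod e) - T p else T p := rfl
    -- If the two paths took different kinds of steps, the equality of residues would force `p ≡ 2 T
    -- p`.
    rcases hc.stepRes_cases (e := e) p with ⟨h₁, h₂⟩ | ⟨h₁, h₂⟩ <;> rcases hT p with h₃ | h₃
    · rw [h₂, hT', if_pos h₃, hcast] at hr
      exact absurd (by linear_combination -hr) hd
    · omega
    · omega
    · rw [h₂, hT', if_neg (by omega), hcast] at hr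
      exact absurd (by linear_combination hr) hd

/-- The path with up-steps and level steps exchanged. -/
def mirror (T : ℕ → ℕ) (p : ℕ) : ℕ := p - T p

/-- With `κ = (0,0)` both components start at residue `0`, so exchanging their roles is invisible to
residues. -/
theorem IsPath.stepRes_mirror {T : ℕ → ℕ} (hT : IsPath m N T) (p : ℕ) :
    stepRes e (mirror T) p = stepRes e T p := by
  have h := hT.le_self p
  have h' := hT.le_self (p + 1)
  have hm : (mirror T p : ZMod e) = p - T p := by rw [mirror, Nat.cast_sub h]
  rcases hT.stepRes_cases (e := e) p with ⟨h₁, h₂⟩ | ⟨h₁, h₂⟩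
  · rw [h₂, stepRes, if_pos (by unfold mirror; omega), hm]; ring
  · rw [h₂, stepRes, if_neg (by unfold mirror; omega), hm]

theorem IsPath.mirror_step {T : ℕ → ℕ} (hT : IsPath m N T) (p : ℕ) :
    mirror T (p + 1) = mirror T p ∨ mirror T (p + 1) = mirror T p + 1 := by
  have h := hT.le_self p
  have h₁ := hT.le_succ p
  have h₂ := hT.succ_le p
  unfold mirror
  omega

theorem IsPath.step {T : ℕ → ℕ} (hT : IsPath m N T) (p : ℕ) :
    T (p + 1) = T p ∨ T (p + 1) = T p + 1 := by
  have h₁ := hT.le_succ p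
  have h₂ := hT.succ_le p
  omega

theorem IsPath.mirror_ne {T : ℕ → ℕ} (hT : IsPath m N T) {p : ℕ}
    (h : (p : ZMod e) ≠ 2 * T p) : (p : ZMod e) ≠ 2 * mirror T p := by
  rw [mirror, Nat.cast_sub (hT.le_self p)]
  intro hh
  exact h (by linear_combination -hh)

/-- If the two available residues always differ, then the residues determine a path up to
exchanging the two kinds of steps. -/
theorem IsPath.eq_or_eq_mirror {c T : ℕ → ℕ} (hc : IsPath m N c) (hT : IsPath m N T) {P : ℕ}
    (hres : ∀ p, p < P → stepRes e c p = stepRes e T p)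
    (hD : ∀ p, 1 ≤ p → p < P → (p : ZMod e) ≠ 2 * T p) :
    (∀ p, p ≤ P → c p = T p) ∨ (∀ p, p ≤ P → c p = mirror T p) := by
  have hm0 : mirror T 0 = 0 := by simp [mirror]
  have hc0 := hc.zero
  have hT0 := hT.zero
  have hc1 := hc.step 0
  have hT1 := hT.step 0
  rw [zero_add] at hc1 hT1
  -- At the origin both kinds of step have residue `0`. This is the only free choice, which is why
  -- `hD` is required only from position `1` on.
  by_cases h : c 1 = T 1
  · left
    intro p hp
    rcases Nat.eq_zero_or_pos p with rfl | hp'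
    · rw [hc0, hT0]
    have := hc.follow hT.step (p₀ := 1) (P := P) (fun p _ h => hres p h) hD (by rw [h]) p hp' hp
    omega
  · right
    intro p hp
    have h1 : c 1 = mirror T 1 := by unfold mirror; omega
    rcases Nat.eq_zero_or_pos p with rfl | hp'
    · rw [hc0, hm0]
    have := hc.follow hT.mirror_step (p₀ := 1) (P := P)
      (fun p _ h => (hres p h).trans (hT.stepRes_mirror p).symm)
      (fun p h h' => hT.mirror_ne (hD p h h')) (by rw [h1]) p hp' hp
    omega

theorem nth_swapSeq_succ (q : ℕ) (i : Fin n → ZMod e) (p : ℕ) (hp : p + 1 ≤ n) :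
    nth (swapSeq (q + 1) i) (p + 1) = nth i (Equiv.swap q (q + 1) p + 1) := by
  rw [nth_swapSeq _ _ _ (by omega) hp]
  congr 1
  simp only [Equiv.swap_apply_def]
  split_ifs <;> omega

end Following

/-! ### No path has the residues and degree of a relator image -/

section GammaPath

variable {e n m : ℕ}

theorem isPath_gammaPath (he : 2 ≤ e) (hm : e ≤ m) :
    IsPath m (2 * m - e + 2) (gammaPath e m) where
  zero := by unfold gammaPath; omega
  le_succ p := by unfold gammaPath; omega
  succ_le p := by unfold gammaPath; omega
  tail p hp := by unfold gammaPath; omega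

/-- The difference `2c - p` grows from `1` to `e - 1` on the initial climb and then alternates
between `e - 1` and `e - 2`, so it stays strictly between `0` and `e`. -/
theorem gammaPath_ne (he : 2 < e) (hm : e ≤ m) {p : ℕ} (h₁ : 1 ≤ p) (h₂ : p ≤ 2 * m - e + 2) :
    (p : ZMod e) ≠ 2 * gammaPath e m p := by
  obtain ⟨δ, hδ₁, hδ₂, hδ⟩ : ∃ δ, 0 < δ ∧ δ < e ∧ 2 * gammaPath e m p = p + δ :=
    ⟨2 * gammaPath e m p - p, by unfold gammaPath; omega, by unfold gammaPath; omega,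
      by unfold gammaPath; omega⟩
  have := congrArg (Nat.cast (R := ZMod e)) hδ
  push_cast at this
  intro h
  exact natCast_zmod_ne_zero hδ₁ hδ₂ (by linear_combination -this - h)

theorem gammaPath_even (he : 2 ≤ e) {i : ℕ} (hi : i ≤ m - e) (hm : e ≤ m) :
    gammaPath e m (e - 1 + 2 * i) = e - 1 + i := by
  unfold gammaPath; omega

theorem gammaPath_odd (he : 2 ≤ e) {i : ℕ} (hi : i ≤ m - e) (hm : e ≤ m) :
    gammaPath e m (e + 2 * i) = e - 1 + i := by
  unfold gammaPath; omega

theorem gammaPath_next (he : 2 ≤ e) {i : ℕ} (hi : i ≤ m - e) (hm : e ≤ m) :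
    gammaPath e m (e + 2 * i + 1) = e + i := by
  unfold gammaPath; omega

theorem stepRes_gammaPath_initial {p : ℕ} (hp : p < e - 1) (hm : e ≤ m) :
    stepRes e (gammaPath e m) p = p := by
  have h : gammaPath e m p = p := by unfold gammaPath; omega
  have h' : gammaPath e m (p + 1) = p + 1 := by unfold gammaPath; omega
  rw [stepRes, h', h, if_neg (by omega)]

theorem stepRes_gammaPath_even (he : 2 ≤ e) {i : ℕ} (hi : i ≤ m - e + 1) (hm : e ≤ m) :
    stepRes e (gammaPath e m) (e - 1 + 2 * i) = i := by
  have h : gammaPath e m (e - 1 + 2 * i) = e - 1 + i := by unfold gammaPath; omega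
  have h' : gammaPath e m (e - 1 + 2 * i + 1) = e - 1 + i := by unfold gammaPath; omega
  rw [stepRes, h', h, if_pos rfl]
  push_cast
  ring

theorem stepRes_gammaPath_odd (he : 2 ≤ e) {i : ℕ} (hi : i ≤ m - e) (hm : e ≤ m) :
    stepRes e (gammaPath e m) (e + 2 * i) = (i : ZMod e) - 1 := by
  rw [stepRes, gammaPath_odd he hi hm, gammaPath_next he hi hm, if_neg (by omega)]
  push_cast [Nat.cast_sub (show 1 ≤ e by omega), ZMod.natCast_self]
  ring

theorem stepRes_gammaPath_tail {p : ℕ} (hp : 2 * m - e + 1 ≤ p) (he : 2 ≤ e) (hm : e ≤ m) :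
    stepRes e (gammaPath e m) p = (p : ZMod e) - m := by
  have h : gammaPath e m p = m := by unfold gammaPath; omega
  have h' : gammaPath e m (p + 1) = m := by unfold gammaPath; omega
  rw [stepRes, h', h, if_pos rfl]

theorem IsPath.pathDeg_two_le_gammaPath {c : ℕ → ℕ} (hm : 2 ≤ m)
    (hc : IsPath m (2 * m - 2 + 2) c) :
    pathDeg 2 (2 * m - 2 + 2) c ≤ pathDeg 2 (2 * m - 2 + 2) (gammaPath 2 m) := by
  have h := (hc.pathDeg_two_le (2 * m - 2 + 2)).1
  rw [hc.tail _ le_rfl] at h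
  rw [pathDeg_gammaPath le_rfl hm, if_pos rfl]
  omega

theorem IsPath.eq_gammaPath_of_pathDeg_two {c : ℕ → ℕ} (hm : 2 ≤ m)
    (hc : IsPath m (2 * m - 2 + 2) c)
    (h : pathDeg 2 (2 * m - 2 + 2) c = pathDeg 2 (2 * m - 2 + 2) (gammaPath 2 m)) {p : ℕ}
    (hp : p ≤ 2 * m) : c p = gammaPath 2 m p := by
  rw [pathDeg_gammaPath le_rfl hm, if_pos rfl] at h
  rw [show 2 * m - 2 + 2 = 2 * m by omega] at hc h
  rw [hc.eq_of_pathDeg_two (by omega) p hp]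
  unfold gammaPath
  omega

/-- For `e > 2` such a path equals `gammaPath` or its mirror on the relevant range; the former has
the wrong degree, and the latter ends at height `m - e + 2 ≠ m`. For `e = 2` the degree would exceed
the maximum. -/
theorem pathDeg_ne_of_pathSeq_eq (he : 2 ≤ e) (hm : e ≤ m) (hN : 2 * m - e + 2 ≤ n) {c : ℕ → ℕ}
    (hc : IsPath m (2 * m - e + 2) c) (h : pathSeq e n c = pathSeq e n (gammaPath e m)) :
    pathDeg e (2 * m - e + 2) c ≠ pathDeg e (2 * m - e + 2) (gammaPath e m) + 2 := by
  have hT := isPath_gammaPath he hm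
  rcases he.eq_or_lt with rfl | he'
  · have := hc.pathDeg_two_le_gammaPath hm
    omega
  have hres : ∀ p, p < 2 * m - e + 2 → stepRes e c p = stepRes e (gammaPath e m) p := by
    intro p hp
    rw [← nth_pathSeq (n := n) c p (by omega), h, nth_pathSeq _ _ (by omega)]
  have hcN := hc.tail _ le_rfl
  rcases hc.eq_or_eq_mirror hT hres
    (fun p h₁ h₂ => gammaPath_ne he' hm h₁ h₂.le) with h' | h'
  · rw [pathDeg_congr h']
    omega
  · have h₁ := h' _ le_rfl
    have h₂ := hT.tail _ le_rfl
    unfold mirror at h₁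
    omega

theorem cartan_gammaPath (he : 2 ≤ e) (a : ZMod e) :
    cartan a (a - 1) = if e = 2 then -2 else -1 := by
  split_ifs with h
  · exact cartan_two h fun hh => one_ne_zero_zmod he (by linear_combination hh)
  · exact cartan_adjacent (by omega) (by ring)

/-- For `e > 2` a path with these residues is parallel to `gammaPath` or to its mirror both before
and after the swapped places. Among the four combinations only one has the right endpoint: the path
with the valley of `gammaPath` filled in. Its degree is one less than that of `gammaPath`, whereas
the crossing demands one more. -/
theorem pathDeg_ne_of_pathSeq_eq_swapSeq (he : 2 ≤ e) (hm : e ≤ m) (hN : 2 * m - e + 2 ≤ n)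
    {i : ℕ} (hi : i ≤ m - e) {c : ℕ → ℕ} (hc : IsPath m (2 * m - e + 2) c)
    (h : pathSeq e n c = swapSeq (e + 2 * i) (pathSeq e n (gammaPath e m))) :
    pathDeg e (2 * m - e + 2) c ≠ pathDeg e (2 * m - e + 2) (gammaPath e m)
      - cartan (nth (pathSeq e n (gammaPath e m)) (e + 2 * i))
        (nth (pathSeq e n (gammaPath e m)) (e + 2 * i + 1)) := by
  obtain ⟨q, hq⟩ : ∃ q, q = e - 1 + 2 * i := ⟨_, rfl⟩
  have hq' : e + 2 * i = q + 1 := by omega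
  have hT := isPath_gammaPath he hm
  have t₀ : gammaPath e m q = e - 1 + i := by rw [hq, gammaPath_even he hi hm]
  have t₁ : gammaPath e m (q + 1) = e - 1 + i := by rw [← hq', gammaPath_odd he hi hm]
  have t₂ : gammaPath e m (q + 2) = e + i := by
    rw [← gammaPath_next he hi hm, hq']
  have r₀ : stepRes e (gammaPath e m) q = i := by
    rw [hq, stepRes_gammaPath_even he (by omega) hm]
  have r₁ : stepRes e (gammaPath e m) (q + 1) = (i : ZMod e) - 1 := by
    rw [← hq', stepRes_gammaPath_odd he hi hm]
  rw [hq'] at h ⊢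
  rw [nth_pathSeq _ _ (by omega), nth_pathSeq _ _ (by omega), r₀, r₁, cartan_gammaPath he]
  rcases he.eq_or_lt with rfl | he'
  · have := hc.pathDeg_two_le_gammaPath hm
    rw [if_pos rfl]
    omega
  rw [if_neg (by omega)]
  have hres : ∀ p, p < 2 * m - e + 2 →
      stepRes e c p = stepRes e (gammaPath e m) (Equiv.swap q (q + 1) p) := by
    intro p hp
    rw [← nth_pathSeq (n := n) c p (by omega), h, nth_swapSeq_succ _ _ _ (by omega), nth_pathSeq]
    rw [Equiv.swap_apply_def]
    split_ifs <;> omega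
  have hres' : ∀ p, p < 2 * m - e + 2 → p ≠ q → p ≠ q + 1 →
      stepRes e c p = stepRes e (gammaPath e m) p := by
    intro p hp h₁ h₂
    rw [hres p hp, Equiv.swap_apply_of_ne_of_ne h₁ h₂]
  have s₀ : stepRes e c q = (i : ZMod e) - 1 := by
    rw [hres q (by omega), Equiv.swap_apply_left, r₁]
  have hD : ∀ p, q + 2 ≤ p → p < 2 * m - e + 2 → (p : ZMod e) ≠ 2 * gammaPath e m p :=
    fun p h₁ h₂ => gammaPath_ne he' hm (by omega) h₂.le
  have hcN := hc.tail _ le_rfl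
  have hTN := hT.tail _ le_rfl
  have hfar : ∀ p, q + 2 ≤ p → p < 2 * m - e + 2 →
      stepRes e c p = stepRes e (gammaPath e m) p :=
    fun p h₁ h₂ => hres' p h₂ (by omega) (by omega)
  have hone := one_ne_zero_zmod he
  have hstep := hc.step (q + 1)
  have hmir : mirror (gammaPath e m) (q + 2) = i + 1 := by unfold mirror; omega
  have hmirN : mirror (gammaPath e m) (2 * m - e + 2) = m - e + 2 := by unfold mirror; omega
  -- Only a congruence modulo `e` at `q + 2` is needed to continue in parallel; the exact height
  -- offset then persists to the endpoint and yields the contradictions below.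
  have par := fun h₀ => hc.follow hT.step hfar hD h₀ _ (show q + 2 ≤ 2 * m - e + 2 by omega) le_rfl
  have anti := fun h₀ => hc.follow hT.mirror_step
    (fun p h₁ h₂ => (hfar p h₁ h₂).trans (hT.stepRes_mirror p).symm)
    (fun p h₁ h₂ => hT.mirror_ne (hD p h₁ h₂)) h₀ _ (show q + 2 ≤ 2 * m - e + 2 by omega) le_rfl
  have ecast : ((e - 1 : ℕ) : ZMod e) = -1 := by
    rw [Nat.cast_sub (by omega), ZMod.natCast_self]; simp
  have qcast : (q : ZMod e) = -1 + 2 * i := by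
    rw [hq]; push_cast [ecast]; ring
  rcases hc.eq_or_eq_mirror hT (P := q)
    (fun p hp => hres' p (by omega) (by omega) (by omega))
    (fun p h₁ h₂ => gammaPath_ne he' hm h₁ (by omega)) with h' | h'
  · have c₀ : c q = e - 1 + i := by rw [h' q le_rfl, t₀]
    have c₁ : c (q + 1) = e + i := by
      rcases hc.stepRes_cases (e := e) q with ⟨h₁, -⟩ | ⟨-, h₂⟩
      · omega
      · rw [s₀, c₀, qcast] at h₂
        push_cast [ecast] at h₂
        exact absurd (by linear_combination -h₂) hone
    rcases hstep with h₁ | h₁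
    · have h₁' : c (q + 2) = c (q + 1) := h₁
      have hp : Peak c q := ⟨by omega, h₁⟩
      have hd := pathDeg_lowerAt (e := e) (n := n) (N := 2 * m - e + 2) (by omega) (by omega) hp
      have hlow : pathDeg e (2 * m - e + 2) (lowerAt c q)
          = pathDeg e (2 * m - e + 2) (gammaPath e m) := by
        refine pathDeg_congr fun p hpN => ?_
        rcases eq_or_ne p (q + 1) with rfl | hpq
        · rw [lowerAt_self, t₁, c₀]
        rw [lowerAt_of_ne c hpq]
        rcases Nat.lt_or_ge p (q + 1) with hlt | hge
        · exact h' p (by omega)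
        · have := hc.follow hT.step hfar hD (by rw [t₂, h₁', c₁]) p (by omega) hpN
          omega
      rw [hlow, h, nth_swapSeq_left _ _ (by omega) (by omega),
        nth_swapSeq_right _ _ (by omega), nth_pathSeq _ _ (by omega), nth_pathSeq _ _ (by omega),
        r₀, r₁, cartan_comm, cartan_gammaPath he, if_neg (by omega)] at hd
      omega
    · have h₁' : c (q + 2) = c (q + 1) + 1 := h₁
      have := anti (by rw [hmir, h₁', c₁]; push_cast [ZMod.natCast_self]; ring)
      omega
  · have c₀ : c q = i := by rw [h' q le_rfl]; unfold mirror; omega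
    have c₁ : c (q + 1) = i := by
      rcases hc.stepRes_cases (e := e) q with ⟨-, h₂⟩ | ⟨h₁, -⟩
      · rw [s₀, c₀] at h₂
        exact absurd (by linear_combination -h₂) hone
      · omega
    rcases hstep with h₁ | h₁
    · have h₁' : c (q + 2) = c (q + 1) := h₁
      have := par (by rw [t₂, h₁', c₁]; push_cast [ZMod.natCast_self]; ring)
      omega
    · have h₁' : c (q + 2) = c (q + 1) + 1 := h₁
      have := anti (by rw [hmir, h₁', c₁])
      omega

/-- For `e > 2` no path has these residues: after following `gammaPath` or its mirror, the available
residues are `i - 1` and `i`, but `i + 1` is required. For `e = 2` the two crossings have opposite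
degrees, so the path would have maximal degree and be `gammaPath` itself, whose residue at this
place is `i`. -/
theorem pathDeg_ne_of_pathSeq_eq_swapSeq_up (he : 2 ≤ e) (hm : e ≤ m) (hN : 2 * m - e + 2 ≤ n)
    {i : ℕ} (hi : i ≤ m - e) {c : ℕ → ℕ} (hc : IsPath m (2 * m - e + 2) c)
    (h : pathSeq e n c
      = swapSeq (e + 2 * i) (swapSeq (e + 2 * i + 1) (pathSeq e n (gammaPath e m)))) :
    pathDeg e (2 * m - e + 2) c ≠ pathDeg e (2 * m - e + 2) (gammaPath e m)
      - cartan (nth (pathSeq e n (gammaPath e m)) (e + 2 * i + 1))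
        (nth (pathSeq e n (gammaPath e m)) (e + 2 * i + 2))
      - cartan (nth (swapSeq (e + 2 * i + 1) (pathSeq e n (gammaPath e m))) (e + 2 * i))
        (nth (swapSeq (e + 2 * i + 1) (pathSeq e n (gammaPath e m))) (e + 2 * i + 1)) := by
  obtain ⟨q, hq⟩ : ∃ q, q = e - 1 + 2 * i := ⟨_, rfl⟩
  have hq' : e + 2 * i = q + 1 := by omega
  have hT := isPath_gammaPath he hm
  have t₀ : gammaPath e m q = e - 1 + i := by rw [hq, gammaPath_even he hi hm]
  have r₀ : stepRes e (gammaPath e m) q = i := by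
    rw [hq, stepRes_gammaPath_even he (by omega) hm]
  have r₁ : stepRes e (gammaPath e m) (q + 1) = (i : ZMod e) - 1 := by
    rw [← hq', stepRes_gammaPath_odd he hi hm]
  have r₂ : stepRes e (gammaPath e m) (q + 2) = (i : ZMod e) + 1 := by
    rw [show q + 2 = e - 1 + 2 * (i + 1) by omega, stepRes_gammaPath_even he (by omega) hm]
    push_cast; ring
  have hone := one_ne_zero_zmod he
  rw [hq'] at h ⊢
  have s₀ : stepRes e c q = (i : ZMod e) + 1 := by
    rw [← nth_pathSeq (n := n) c q (by omega), h, nth_swapSeq_left _ _ (by omega) (by omega),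
      nth_swapSeq_left _ _ (by omega) (by omega), nth_pathSeq _ _ (by omega), r₂]
  rw [nth_swapSeq_of_ne _ _ _ (by omega) (by omega) (by omega) (by omega),
    nth_swapSeq_left _ _ (by omega) (by omega), show q + 1 + 2 = q + 2 + 1 from rfl,
    show q + 1 + 1 + 1 = q + 2 + 1 from rfl,
    nth_pathSeq _ _ (by omega), nth_pathSeq _ _ (by omega), nth_pathSeq _ _ (by omega), r₀, r₁, r₂]
  rcases he.eq_or_lt with rfl | he'
  · have h2 : (2 : ZMod 2) = 0 := rfl
    rw [show (i : ZMod 2) + 1 = i - 1 by linear_combination h2, cartan_self le_rfl,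
      cartan_two rfl fun hh => hone (by linear_combination hh)]
    intro hd
    have hT' := fun p hp => hc.eq_gammaPath_of_pathDeg_two hm (by rw [hd]; ring) (p := p) hp
    have : stepRes 2 c q = stepRes 2 (gammaPath 2 m) q := by
      rw [stepRes, stepRes, hT' q (by omega), hT' (q + 1) (by omega)]
    rw [s₀, r₀] at this
    exact absurd (by linear_combination this) hone
  exfalso
  have htwo := two_ne_zero_zmod he'
  have ecast : ((e - 1 : ℕ) : ZMod e) = -1 := by
    rw [Nat.cast_sub (by omega), ZMod.natCast_self]; simp
  have qcast : (q : ZMod e) = -1 + 2 * i := by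
    rw [hq]; push_cast [ecast]; ring
  have hres : ∀ p, p < q → stepRes e c p = stepRes e (gammaPath e m) p := by
    intro p hp
    rw [← nth_pathSeq (n := n) c p (by omega), h,
      nth_swapSeq_of_ne _ _ _ (by omega) (by omega) (by omega) (by omega),
      nth_swapSeq_of_ne _ _ _ (by omega) (by omega) (by omega) (by omega),
      nth_pathSeq _ _ (by omega)]
  rcases hc.eq_or_eq_mirror hT (P := q) hres
    (fun p h₁ h₂ => gammaPath_ne he' hm h₁ (by omega)) with h' | h'
  · have c₀ : c q = e - 1 + i := by rw [h' q le_rfl, t₀]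
    rcases hc.stepRes_cases (e := e) q with ⟨-, h₂⟩ | ⟨-, h₂⟩ <;>
      rw [s₀, c₀] at h₂ <;> push_cast [ecast, qcast] at h₂
    · exact htwo (by linear_combination h₂)
    · exact hone (by linear_combination h₂)
  · have c₀ : c q = i := by rw [h' q le_rfl]; unfold mirror; omega
    rcases hc.stepRes_cases (e := e) q with ⟨-, h₂⟩ | ⟨-, h₂⟩ <;>
      rw [s₀, c₀] at h₂ <;> push_cast [ecast, qcast] at h₂
    · exact hone (by linear_combination h₂)
    · exact htwo (by linear_combination h₂)

/-- Here the first altered residue `i + 1` can still be realised, by one kind of step only; for `e >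
2` the next residue `i` then differs from both available ones, `i - 1` and `i + 2`. The case `e = 2`
again uses uniqueness in maximal degree. -/
theorem pathDeg_ne_of_pathSeq_eq_swapSeq_down (he : 2 ≤ e) (hm : e ≤ m) (hN : 2 * m - e + 2 ≤ n)
    {i : ℕ} (hi : i + 1 ≤ m - e) {c : ℕ → ℕ} (hc : IsPath m (2 * m - e + 2) c)
    (h : pathSeq e n c
      = swapSeq (e + 2 * i + 2) (swapSeq (e + 2 * i + 1) (pathSeq e n (gammaPath e m)))) :
    pathDeg e (2 * m - e + 2) c ≠ pathDeg e (2 * m - e + 2) (gammaPath e m)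
      - cartan (nth (pathSeq e n (gammaPath e m)) (e + 2 * i + 1))
        (nth (pathSeq e n (gammaPath e m)) (e + 2 * i + 2))
      - cartan (nth (swapSeq (e + 2 * i + 1) (pathSeq e n (gammaPath e m))) (e + 2 * i + 2))
        (nth (swapSeq (e + 2 * i + 1) (pathSeq e n (gammaPath e m))) (e + 2 * i + 3)) := by
  obtain ⟨p, hp⟩ : ∃ p, p = e + 2 * i := ⟨_, rfl⟩
  have hT := isPath_gammaPath he hm
  have t₀ : gammaPath e m p = e - 1 + i := by rw [hp, gammaPath_odd he (by omega) hm]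
  have r₀ : stepRes e (gammaPath e m) p = (i : ZMod e) - 1 := by
    rw [hp, stepRes_gammaPath_odd he (by omega) hm]
  have r₁ : stepRes e (gammaPath e m) (p + 1) = (i : ZMod e) + 1 := by
    rw [show p + 1 = e - 1 + 2 * (i + 1) by omega, stepRes_gammaPath_even he (by omega) hm]
    push_cast; ring
  have r₂ : stepRes e (gammaPath e m) (p + 2) = (i : ZMod e) := by
    rw [show p + 2 = e + 2 * (i + 1) by omega, stepRes_gammaPath_odd he (by omega) hm]
    push_cast; ring
  have hone := one_ne_zero_zmod he
  rw [← hp] at h ⊢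
  have s₀ : stepRes e c p = (i : ZMod e) + 1 := by
    rw [← nth_pathSeq (n := n) c p (by omega), h,
      nth_swapSeq_of_ne _ _ _ (by omega) (by omega) (by omega) (by omega),
      nth_swapSeq_left _ _ (by omega) (by omega), nth_pathSeq _ _ (by omega), r₁]
  have s₁ : stepRes e c (p + 1) = (i : ZMod e) := by
    rw [← nth_pathSeq (n := n) c (p + 1) (by omega), h, show p + 1 + 1 = p + 2 from rfl,
      nth_swapSeq_left _ _ (by omega) (by omega), show p + 2 + 1 = p + 3 from rfl,
      nth_swapSeq_of_ne _ _ _ (by omega) (by omega) (by omega) (by omega),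
      nth_pathSeq _ _ (by omega), r₂]
  rw [nth_swapSeq_of_ne _ _ (p + 3) (by omega) (by omega) (by omega) (by omega),
    nth_swapSeq_right _ _ (by omega),
    nth_pathSeq _ _ (by omega), nth_pathSeq _ _ (by omega), nth_pathSeq _ _ (by omega), r₀, r₁, r₂]
  rcases he.eq_or_lt with rfl | he'
  · have h2 : (2 : ZMod 2) = 0 := rfl
    rw [show (i : ZMod 2) + 1 = i - 1 by linear_combination h2, cartan_self le_rfl,
      cartan_two rfl fun hh => hone (by linear_combination -hh)]
    intro hd
    have hT' := fun p hp => hc.eq_gammaPath_of_pathDeg_two hm (by rw [hd]; ring) (p := p) hp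
    have : stepRes 2 c (p + 1) = stepRes 2 (gammaPath 2 m) (p + 1) := by
      rw [stepRes, stepRes, hT' (p + 1) (by omega), hT' (p + 1 + 1) (by omega)]
    rw [s₁, r₁] at this
    exact absurd (by linear_combination -this) hone
  exfalso
  have htwo := two_ne_zero_zmod he'
  have ecast : ((e - 1 : ℕ) : ZMod e) = -1 := by
    rw [Nat.cast_sub (by omega), ZMod.natCast_self]; simp
  have pcast : (p : ZMod e) = 2 * i := by
    rw [hp]; push_cast [ZMod.natCast_self]; ring
  have hres : ∀ p', p' < p → stepRes e c p' = stepRes e (gammaPath e m) p' := by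
    intro p' hp'
    rw [← nth_pathSeq (n := n) c p' (by omega), h,
      nth_swapSeq_of_ne _ _ _ (by omega) (by omega) (by omega) (by omega),
      nth_swapSeq_of_ne _ _ _ (by omega) (by omega) (by omega) (by omega),
      nth_pathSeq _ _ (by omega)]
  rcases hc.eq_or_eq_mirror hT (P := p) hres
    (fun p h₁ h₂ => gammaPath_ne he' hm h₁ (by omega)) with h' | h'
  · have c₀ : c p = e - 1 + i := by rw [h' p le_rfl, t₀]
    rcases hc.stepRes_cases (e := e) p with ⟨-, h₂⟩ | ⟨h₁, -⟩
    · rw [s₀, c₀] at h₂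
      push_cast [ecast] at h₂
      exact htwo (by linear_combination h₂)
    rcases hc.stepRes_cases (e := e) (p + 1) with ⟨-, h₂⟩ | ⟨-, h₂⟩ <;>
      rw [s₁, h₁, c₀] at h₂ <;> push_cast [ecast, pcast] at h₂
    · exact hone (by linear_combination h₂)
    · exact htwo (by linear_combination -h₂)
  · have c₀ : c p = i + 1 := by rw [h' p le_rfl]; unfold mirror; omega
    rcases hc.stepRes_cases (e := e) p with ⟨h₁, -⟩ | ⟨-, h₂⟩
    · rcases hc.stepRes_cases (e := e) (p + 1) with ⟨-, h₂⟩ | ⟨-, h₂⟩ <;>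
        rw [s₁, h₁, c₀] at h₂ <;> push_cast [ecast, pcast] at h₂
      · exact htwo (by linear_combination -h₂)
      · exact hone (by linear_combination h₂)
    · rw [s₀, c₀] at h₂
      push_cast [pcast] at h₂
      exact htwo (by linear_combination h₂)

end GammaPath

/-! ### The relators of the source annihilate the image vector -/

section Vanishing

variable {F : Type*} [Field F] {e : ℕ} [NeZero e] {n : ℕ} {κ : Fin 2 → ZMod e}
variable {M : Type*} [AddCommGroup M] [Module (CycKLR F n κ) M]
variable {m : ℕ} {z : M}

/-- The first `e - 1` factors of the product are trivial, and factor `s ≥ e` involves only `ψ_s, …,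
ψ_{2s-e}`. All indices thus lie between `e` and `2m - e`, at distance at least two from `r`. -/
theorem commute_psi_psiTab (he : 2 ≤ e) (hm : e ≤ m) {r : ℕ}
    (hr : r + 2 ≤ e ∨ 2 * m - e + 2 ≤ r) :
    Commute (psi F n κ r) (psiTab F κ n m (gammaEntry e)) := by
  refine Commute.list_prod_right _ _ fun x hx => ?_
  obtain ⟨s, hs, rfl⟩ := List.mem_map.1 hx
  refine Commute.list_prod_right _ _ fun x hx => ?_
  obtain ⟨t, ht, rfl⟩ := List.mem_map.1 hx
  rw [List.mem_reverse, List.mem_range'_1] at ht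
  rw [List.mem_range] at hs
  refine psi_mul_psi F n κ r t ?_
  unfold gammaEntry at ht
  split_ifs at ht <;> omega

/-- The hypotheses on the generator `z` that are used. -/
structure IsRowVector (F : Type*) [Field F] {e : ℕ} [NeZero e] (n : ℕ) (κ : Fin 2 → ZMod e)
    {M : Type*} [AddCommGroup M] [Module (CycKLR F n κ) M] (m : ℕ) (z : M) : Prop where
  idem_smul : idem F κ (pathSeq e n fun p => min p m) • z = z
  y_smul : ∀ r, y F n κ r • z = 0
  psi_smul : ∀ r, 1 ≤ r → r + 1 ≤ n → r ≠ m → psi F n κ r • z = 0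

theorem IsRowVector.psi_smul_gamma_of_far (hz : IsRowVector F n κ m z)
    (he : 2 ≤ e) (hm : e ≤ m) {r : ℕ} (h₁ : 1 ≤ r)
    (h₂ : r + 1 ≤ n) (hr : r + 2 ≤ e ∨ 2 * m - e + 2 ≤ r) :
    psi F n κ r • psiTab F κ n m (gammaEntry e) • z = 0 := by
  rw [← mul_smul, (commute_psi_psiTab he hm hr).eq, mul_smul, hz.psi_smul r h₁ h₂ (by omega),
    smul_zero]

theorem IsRowVector.actsUpTo (hz : IsRowVector F n κ m z)
    (he : 2 ≤ e) (hN : 2 * m - e + 2 ≤ n) (L : ℕ) :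
    ActsUpTo F n κ m (2 * m - e + 2) z L :=
  BihookSpecht.actsUpTo he hN hz.idem_smul hz.y_smul
    (fun q hq hqm => hz.psi_smul (q + 1) (by omega) (by omega) hqm) L

theorem IsRowVector.idem_smul_gamma (hz : IsRowVector F n κ m z)
    (he : 2 ≤ e) (hm : e ≤ m) (hN : 2 * m - e + 2 ≤ n) :
    idem F κ (pathSeq e n (gammaPath e m)) • psiTab F κ n m (gammaEntry e) • z
      = psiTab F κ n m (gammaEntry e) • z := by
  obtain ⟨L, hL⟩ := (pathOf_gammaEntry he hm).reach_psiTab (F := F) (n := n) (κ := κ) (z := z)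
  exact hL.idem_smul hN hz.idem_smul

theorem exists_gamma_mem_reachSpan (he : 2 ≤ e) (hm : e ≤ m) :
    ∃ K, psiTab F κ n m (gammaEntry e) • z ∈ reachSpan F n κ m (2 * m - e + 2) z
      (pathSeq e n (gammaPath e m)) (pathDeg e (2 * m - e + 2) (gammaPath e m)) K := by
  obtain ⟨L, hL⟩ := (pathOf_gammaEntry he hm).reach_psiTab (F := F) (n := n) (κ := κ) (z := z)
  exact ⟨L + 1, hL.mem_reachSpan (Nat.lt_succ_self L)⟩

theorem IsRowVector.y_smul_gamma (hz : IsRowVector F n κ m z)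
    (he : 2 ≤ e) (hm : e ≤ m) (hN : 2 * m - e + 2 ≤ n) (r : ℕ) :
    y F n κ r • psiTab F κ n m (gammaEntry e) • z = 0 := by
  obtain ⟨K, hK⟩ := exists_gamma_mem_reachSpan (F := F) (n := n) (κ := κ) (z := z) he hm
  exact eq_zero_of_mem_reachSpan ((hz.actsUpTo he hN K).y_smul_mem le_rfl hK r)
    fun c hc h => pathDeg_ne_of_pathSeq_eq he hm hN hc h

theorem IsRowVector.psi_smul_gamma (hz : IsRowVector F n κ m z)
    (he : 2 ≤ e) (hm : e ≤ m) (hN : 2 * m - e + 2 ≤ n) {i : ℕ}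
    (hi : i ≤ m - e) :
    psi F n κ (e + 2 * i) • psiTab F κ n m (gammaEntry e) • z = 0 := by
  obtain ⟨K, hK⟩ := exists_gamma_mem_reachSpan (F := F) (n := n) (κ := κ) (z := z) he hm
  obtain ⟨q, hq⟩ : ∃ q, e + 2 * i = q + 1 := ⟨e + 2 * i - 1, by omega⟩
  have h := (hz.actsUpTo he hN K).psi_smul_mem hN le_rfl hK q (by omega)
  have key := fun c hc h => pathDeg_ne_of_pathSeq_eq_swapSeq (n := n) he hm hN hi (c := c) hc h
  rw [hq] at key ⊢
  exact eq_zero_of_mem_reachSpan h key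

theorem IsRowVector.psi_psi_smul_gamma_up (hz : IsRowVector F n κ m z)
    (he : 2 ≤ e) (hm : e ≤ m) (hN : 2 * m - e + 2 ≤ n) {i : ℕ} (hi : i ≤ m - e) :
    psi F n κ (e + 2 * i) • psi F n κ (e + 2 * i + 1) • psiTab F κ n m (gammaEntry e) • z = 0 := by
  obtain ⟨K, hK⟩ := exists_gamma_mem_reachSpan (F := F) (n := n) (κ := κ) (z := z) he hm
  obtain ⟨q, hq⟩ : ∃ q, e + 2 * i = q + 1 := ⟨e + 2 * i - 1, by omega⟩
  -- The first crossing raises the bound from `K` to `K + 1`, so the second one needs control of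
  -- vectors up to that length.
  have hA := hz.actsUpTo he hN (K + 1)
  have h := hA.psi_smul_mem hN le_rfl
    (hA.psi_smul_mem hN (by omega) hK (q + 1) (by omega)) q (by omega)
  have key := fun c hc h => pathDeg_ne_of_pathSeq_eq_swapSeq_up (n := n) he hm hN hi (c := c) hc h
  rw [hq] at key ⊢
  exact eq_zero_of_mem_reachSpan h key

theorem IsRowVector.psi_psi_smul_gamma_down (hz : IsRowVector F n κ m z)
    (he : 2 ≤ e) (hm : e ≤ m) (hN : 2 * m - e + 2 ≤ n) {i : ℕ} (hi : i + 1 ≤ m - e) :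
    psi F n κ (e + 2 * i + 2) • psi F n κ (e + 2 * i + 1)
      • psiTab F κ n m (gammaEntry e) • z = 0 := by
  obtain ⟨K, hK⟩ := exists_gamma_mem_reachSpan (F := F) (n := n) (κ := κ) (z := z) he hm
  have hA := hz.actsUpTo he hN (K + 1)
  have h := hA.psi_smul_mem hN le_rfl
    (hA.psi_smul_mem hN (by omega) hK (e + 2 * i) (by omega)) (e + 2 * i + 1) (by omega)
  exact eq_zero_of_mem_reachSpan h
    fun c hc h => pathDeg_ne_of_pathSeq_eq_swapSeq_down (n := n) he hm hN hi (c := c) hc h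

end Vanishing

/-! ### Homogeneity of the map -/

section Grading

variable {F : Type*} [Field F] {e : ℕ} [NeZero e] {n : ℕ} {κ : Fin 2 → ZMod e} {m N : ℕ}

/-- Here the algebra itself serves as the module and an idempotent as the starting vector. A bare
`ψ` is not homogeneous, so the idempotent of the current path is inserted before each crossing. -/
theorem Reach.monomial (hN : N ≤ n) {L : ℕ} {c : ℕ → ℕ} {v : CycKLR F n κ}
    (h : Reach F n κ m N (idem F κ (pathSeq e n fun p => min p m)) L c v)
    (α : {α : ZMod e → ℕ // ∑ a, α a = n}) :
    Monomial F n κ α.1 (pathDeg e N c - pathDeg e N fun p => min p m) (v α) := by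
  induction h with
  | base =>
    rw [sub_self]
    exact Monomial.idem _
  | @step L c v q hq hp hv ih =>
    have hi : idem F κ (pathSeq e n c) • v = v := by
      refine hv.idem_smul hN ?_
      rw [smul_eq_mul, idem_mul_idem, if_pos rfl]
    have h := ih.psi (q + 1) (pathSeq e n c) (by omega) (by omega)
    have e₁ : (psi F n κ (q + 1) • v) α
        = toBlock F n κ α.1 (fP F e n (q + 1)) * toBlock F n κ α.1 (fE F n (pathSeq e n c))
          * v α := by
      conv_lhs => rw [← hi]
      rw [mul_assoc]
      rfl
    rw [e₁, pathDeg_lowerAt (n := n) hq (by omega) hp]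
    convert h using 1
    ring

/-- The hypothesis `hi` settles the base case: an idempotent monomial times `u` is either `u` or
`0`. -/
theorem mul_mem_blockDeg {α : ZMod e → ℕ} {d δ : ℤ} {x u : Block F n κ α} {i : Fin n → ZMod e}
    (hx : x ∈ blockDeg F n κ α d) (hu : Monomial F n κ α δ u)
    (hi : toBlock F n κ α (fE F n i) * u = u) : x * u ∈ blockDeg F n κ α (d + δ) := by
  have key : ∀ d x, Monomial F n κ α d x → x * u ∈ blockDeg F n κ α (d + δ) := by
    intro d x hx
    induction hx with
    | idem i' =>
      rw [← hi, ← mul_assoc, ← map_mul, toBlock_rel F n κ (Rel.idem_mul i' i), zero_add]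
      split_ifs with h
      · rw [h, hi]
        exact Submodule.subset_span hu
      · rw [map_zero, zero_mul]
        exact zero_mem _
    | @y r d x _ ih =>
      rw [mul_assoc, show d + 2 + δ = d + δ + 2 by ring]
      generalize x * u = w at ih
      generalize d + δ = d' at ih
      induction ih using Submodule.span_induction with
      | mem w hw => exact Submodule.subset_span (hw.y r)
      | zero => rw [mul_zero]; exact zero_mem _
      | add a b _ _ ha hb => rw [mul_add]; exact add_mem ha hb
      | smul f a _ ha => rw [mul_smul_comm]; exact Submodule.smul_mem _ _ ha
    | @psi r i' h₁ h₂ d x _ ih =>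
      rw [mul_assoc, show d - cartan (nth i' r) (nth i' (r + 1)) + δ
        = d + δ - cartan (nth i' r) (nth i' (r + 1)) by ring]
      generalize x * u = w at ih
      generalize d + δ = d' at ih
      induction ih using Submodule.span_induction with
      | mem w hw => exact Submodule.subset_span (hw.psi r i' h₁ h₂)
      | zero => rw [mul_zero]; exact zero_mem _
      | add a b _ _ ha hb => rw [mul_add]; exact add_mem ha hb
      | smul f a _ ha => rw [mul_smul_comm]; exact Submodule.smul_mem _ _ ha
  induction hx using Submodule.span_induction with
  | mem w hw => exact key d w hw
  | zero => rw [zero_mul]; exact zero_mem _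
  | add a b _ _ ha hb => rw [add_mul]; exact add_mem ha hb
  | smul f a _ ha => rw [smul_mul_assoc]; exact Submodule.smul_mem _ _ ha

theorem Reach.mul_mem_klrDeg (hN : N ≤ n) {L : ℕ} {c : ℕ → ℕ} {v : CycKLR F n κ}
    (h : Reach F n κ m N (idem F κ (pathSeq e n fun p => min p m)) L c v) {d : ℤ}
    {x : CycKLR F n κ} (hx : x ∈ klrDeg F n κ d) :
    x * v ∈ klrDeg F n κ (d + (pathDeg e N c - pathDeg e N fun p => min p m)) := by
  have hi : idem F κ (pathSeq e n c) • v = v := by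
    refine h.idem_smul hN ?_
    rw [smul_eq_mul, idem_mul_idem, if_pos rfl]
  intro α hα
  exact mul_mem_blockDeg (hx α hα) (h.monomial hN α) (congrFun hi α)

end Grading

/-! ### Column-initial tableaux made explicit -/

section Tableaux

/-- The nodes of the column-initial tableau of `((a), (m))`. -/
def rowPairNode (m t : ℕ) : Node := if t < m then (1, 0, t) else (0, 0, t - m)

/-- The nodes of the first component in the column-initial tableau of `((a, s), (b))`. -/
def twoRowNode (s t : ℕ) : Node :=
  if t < 2 * s then (0, t % 2, t / 2) else (0, 0, t - s)

/-- The nodes of the column-initial tableau of `((a, m - e + 1), (e - 1))`. -/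
def twoRowPairNode (e m t : ℕ) : Node :=
  if t < e - 1 then (1, 0, t) else twoRowNode (m - e + 1) (t - (e - 1))

theorem componentNodes_singleton (i : Fin 2) (m : ℕ) :
    componentNodes i [m] = (List.range m).map fun c => (i, 0, c) := by
  have h : ∀ K, K ≤ m → ((List.range K).flatMap fun c =>
      (List.range ([m].countP fun x => c < x)).map fun r => ((i, r, c) : Node))
      = (List.range K).map fun c => (i, 0, c) := by
    intro K hK
    induction K with
    | zero => rfl
    | succ K ih =>
      rw [List.range_succ, List.flatMap_append, ih (by omega), List.map_append]
      have : K < m := by omega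
      simp [this]
  exact h m le_rfl

theorem componentNodes_pair (a s : ℕ) (h : s ≤ a) :
    componentNodes 0 [a, s] = (List.range (a + s)).map (twoRowNode s) := by
  have h₁ : ∀ K, K ≤ s → ((List.range K).flatMap fun c =>
      (List.range ([a, s].countP fun x => c < x)).map fun r => ((0, r, c) : Node))
      = (List.range (2 * K)).map (twoRowNode s) := by
    intro K hK
    induction K with
    | zero => rfl
    | succ K ih =>
      rw [List.range_succ, List.flatMap_append, ih (by omega),
        show 2 * (K + 1) = 2 * K + 1 + 1 by ring, List.range_succ, List.range_succ,
        List.map_append, List.map_append, List.append_assoc]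
      have h₁ : K < a := by omega
      have h₂ : K < s := by omega
      have h₃ : 2 * K + 1 < 2 * s := by omega
      have h₄ : (2 * K + 1) / 2 = K := by omega
      simp [h₁, h₂, h₃, h₄, twoRowNode, List.range_succ]
  have h₂ : ∀ l, s + l ≤ a → ((List.range (s + l)).flatMap fun c =>
      (List.range ([a, s].countP fun x => c < x)).map fun r => ((0, r, c) : Node))
      = (List.range (2 * s + l)).map (twoRowNode s) := by
    intro l hl
    induction l with
    | zero => exact h₁ s le_rfl
    | succ l ih =>
      rw [← add_assoc, ← add_assoc, List.range_succ, List.flatMap_append, ih (by omega),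
        List.range_succ, List.map_append]
      have h₁ : s + l < a := by omega
      have h₃ : 2 * s + l - s = s + l := by omega
      simp [h₁, h₃, twoRowNode]
  have := h₂ (a - s) (by omega)
  rw [show s + (a - s) = a by omega, show 2 * s + (a - s) = a + s by omega] at this
  exact this

theorem colInitial_eq {n : ℕ} (ν : Bipartition n) (f : ℕ → Node)
    (h : columnNodes ν = (List.range n).map f) (t : Fin n) : colInitial ν t = f t := by
  simp [colInitial, h]

theorem colInitial_rowPair (e j k : ℕ) (t : Fin (k * e + j * e)) :
    colInitial (rowPair e j k) t = rowPairNode (j * e) t := by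
  refine colInitial_eq _ _ ?_ t
  have h : columnNodes (rowPair e j k) = componentNodes 1 [j * e] ++ componentNodes 0 [k * e] := rfl
  rw [h, componentNodes_singleton, componentNodes_singleton, add_comm (k * e), List.range_add,
    List.map_append, List.map_map]
  congr 1
  · refine List.map_congr_left fun t ht => ?_
    rw [rowPairNode, if_pos (List.mem_range.1 ht)]
  · refine List.map_congr_left fun t ht => ?_
    simp [rowPairNode]

theorem colInitial_twoRowPair (e j k : ℕ) (he : 2 ≤ e) (hj : 1 ≤ j) (hjk : j ≤ k)
    (t : Fin (k * e + j * e)) :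
    colInitial (twoRowPair e j k he hj hjk) t = twoRowPairNode e (j * e) t := by
  refine colInitial_eq _ _ ?_ t
  have h : columnNodes (twoRowPair e j k he hj hjk)
      = componentNodes 1 [e - 1] ++ componentNodes 0 [k * e, j * e - e + 1] := rfl
  have h₁ : j * e ≤ k * e := Nat.mul_le_mul_right e hjk
  have h₂ : 1 * e ≤ j * e := Nat.mul_le_mul_right e hj
  rw [h, componentNodes_singleton, componentNodes_pair _ _ (by omega),
    show k * e + j * e = e - 1 + (k * e + (j * e - e + 1)) by omega]
  generalize k * e + (j * e - e + 1) = K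
  rw [List.range_add,
    List.map_append, List.map_map]
  congr 1
  · refine List.map_congr_left fun t ht => ?_
    rw [twoRowPairNode, if_pos (List.mem_range.1 ht)]
  · refine List.map_congr_left fun t ht => ?_
    simp [twoRowPairNode]

theorem colResidues_rowPair (e j k : ℕ) (κ : Fin 2 → ZMod e) (hκ : κ = ![0, 0]) :
    colResidues κ (rowPair e j k) = pathSeq e (k * e + j * e) fun p => min p (j * e) := by
  funext t
  rw [colResidues, colInitial_rowPair, hκ, pathSeq, stepRes, rowPairNode]
  split_ifs with h₁ h₂ h₂
  · omega
  · rw [min_eq_left h₁.le]; simp [res]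
  · rw [min_eq_right (not_lt.1 h₁)]; simp [res, Nat.cast_sub (not_lt.1 h₁)]
  · omega

theorem twoRowPairNode_cases {e m : ℕ} (he : 2 ≤ e) (hm : e ≤ m) (t : ℕ) :
    (t < e - 1 ∧ twoRowPairNode e m t = (1, 0, t)) ∨
    (∃ i, i ≤ m - e ∧ t = e - 1 + 2 * i ∧ twoRowPairNode e m t = (0, 0, i)) ∨
    (∃ i, i ≤ m - e ∧ t = e + 2 * i ∧ twoRowPairNode e m t = (0, 1, i)) ∨
    (2 * m - e + 1 ≤ t ∧ twoRowPairNode e m t = (0, 0, t - m)) := by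
  unfold twoRowPairNode twoRowNode
  by_cases h₁ : t < e - 1
  · exact Or.inl ⟨h₁, if_pos h₁⟩
  rw [if_neg h₁]
  by_cases h₂ : t - (e - 1) < 2 * (m - e + 1)
  · rw [if_pos h₂]
    rcases Nat.mod_two_eq_zero_or_one (t - (e - 1)) with h₃ | h₃
    · exact Or.inr (Or.inl ⟨(t - (e - 1)) / 2, by omega, by omega, by rw [h₃]⟩)
    · exact Or.inr (Or.inr (Or.inl ⟨(t - (e - 1)) / 2, by omega, by omega, by rw [h₃]⟩))
  · rw [if_neg h₂]
    exact Or.inr (Or.inr (Or.inr ⟨by omega, by congr 2; omega⟩))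

/-- This coincidence makes the image vector plausible: reading the second component of `t_λ` and
then the second row of its first component as up-steps gives `gammaPath`. The second row starts at
residue `-1`, which continues the `e - 1` nodes of the second component. -/
theorem colResidues_twoRowPair (e j k : ℕ) (he : 2 ≤ e) (hj : 1 ≤ j) (hjk : j ≤ k)
    (κ : Fin 2 → ZMod e) (hκ : κ = ![0, 0]) :
    colResidues κ (twoRowPair e j k he hj hjk)
      = pathSeq e (k * e + j * e) (gammaPath e (j * e)) := by
  have hm : e ≤ j * e := by nlinarith
  funext t
  rw [colResidues, colInitial_twoRowPair, hκ, pathSeq]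
  rcases twoRowPairNode_cases he hm t with ⟨h, h'⟩ | ⟨i, hi, h, h'⟩ | ⟨i, hi, h, h'⟩ | ⟨h, h'⟩
  · rw [h', stepRes_gammaPath_initial h hm]; simp [res]
  · rw [h', h, stepRes_gammaPath_even he (by omega) hm]; simp [res]
  · rw [h', h, stepRes_gammaPath_odd he hi hm]; simp [res]
  · rw [h', stepRes_gammaPath_tail h he hm]; simp [res, Nat.cast_sub (show j * e ≤ t by omega)]

end Tableaux

/-! ### Codegrees of the two column-initial tableaux -/

section Codegree

variable {e : ℕ} {D : Finset Node}

theorem dAbove_first_row (κ : Fin 2 → ZMod e) (D : Finset Node) (c : ℕ) :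
    dAbove κ D (0, 0, c) = 0 := by
  have h : ∀ B : Node, ¬ Above B (0, 0, c) := by
    intro B
    simp [Above]
  simp [dAbove, h]

theorem ncard_singleton_if {p : Prop} [Decidable p] {A : Node} {S : Set Node}
    (h : ∀ B, B ∈ S ↔ B = A ∧ p) : (S.ncard : ℤ) = if p then 1 else 0 := by
  split_ifs with hp
  · rw [show S = {A} by ext B; simp [h, hp], Set.ncard_singleton]; rfl
  · rw [show S = ∅ by ext B; simp [h, hp], Set.ncard_empty]; rfl

/-- The first component is still empty, so the only candidate above is its first node, addable of
residue `0`. -/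
theorem dAbove_second_component (c : ℕ)
    (hD : ∀ x : Node, x ∈ D ↔ x.1 = 1 ∧ x.2.1 = 0 ∧ x.2.2 ≤ c) :
    dAbove (![0, 0] : Fin 2 → ZMod e) D (1, 0, c) = if (c : ZMod e) = 0 then 1 else 0 := by
  have habove : ∀ B : Node, Above B (1, 0, c) ↔ B.1 = 0 := by
    rintro ⟨i, r, c'⟩
    simp only [Above]
    omega
  have h₁ : ({B : Node | Addable D B ∧ res (![0, 0] : Fin 2 → ZMod e) B = res ![0, 0] (1, 0, c) ∧
      Above B (1, 0, c)}.ncard : ℤ) = if (c : ZMod e) = 0 then 1 else 0 := by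
    refine ncard_singleton_if (A := (0, 0, 0)) fun B => ?_
    simp only [Set.mem_ofPred_eq, habove]
    constructor
    · rintro ⟨⟨hB, hdiag⟩, hres, h0⟩
      have hB0 : B = (0, 0, 0) := by
        obtain ⟨i, r, c'⟩ := B
        simp only at h0
        subst h0
        have := hdiag 0 r c' (by simp) 0 0 (by omega) (by omega)
        rw [Finset.mem_insert, hD] at this
        rcases this with h | h
        · exact h.symm
        · simp at h
      subst hB0
      exact ⟨rfl, by simpa [res] using hres.symm⟩
    · rintro ⟨rfl, hc⟩
      refine ⟨⟨by simp [hD], ?_⟩, by simp [res, hc], rfl⟩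
      intro i r c' h r' c'' hr hc'
      simp only [Finset.mem_insert, hD, Prod.mk.injEq] at h ⊢
      omega
  have h₂ : ({B : Node | Removable D B ∧ res (![0, 0] : Fin 2 → ZMod e) B = res ![0, 0] (1, 0, c) ∧
      Above B (1, 0, c)}.ncard : ℤ) = if False then 1 else 0 := by
    refine ncard_singleton_if (A := (0, 0, 0)) fun B => ?_
    simp only [Set.mem_ofPred_eq, habove, and_false, iff_false]
    rintro ⟨⟨hB, -⟩, -, h0⟩
    rw [hD, h0] at hB
    simp at hB
  rw [dAbove, h₁, h₂, if_neg not_false, sub_zero]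

/-- The two rows have equal length, so the first has no removable node and its only addable node is
in column `c + 1`. Its residue exceeds that of the node considered by `2`. -/
theorem dAbove_second_row (b c : ℕ)
    (hD : ∀ x : Node, x ∈ D ↔
      (x.1 = 1 ∧ x.2.1 = 0 ∧ x.2.2 < b) ∨ (x.1 = 0 ∧ x.2.1 ≤ 1 ∧ x.2.2 ≤ c)) :
    dAbove (![0, 0] : Fin 2 → ZMod e) D (0, 1, c) = if (2 : ZMod e) = 0 then 1 else 0 := by
  have habove : ∀ B : Node, Above B (0, 1, c) ↔ B.1 = 0 ∧ B.2.1 = 0 := by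
    rintro ⟨i, r, c'⟩
    simp only [Above]
    omega
  have h₁ : ({B : Node | Addable D B ∧ res (![0, 0] : Fin 2 → ZMod e) B = res ![0, 0] (0, 1, c) ∧
      Above B (0, 1, c)}.ncard : ℤ) = if (2 : ZMod e) = 0 then 1 else 0 := by
    refine ncard_singleton_if (A := (0, 0, c + 1)) fun B => ?_
    simp only [Set.mem_ofPred_eq, habove]
    constructor
    · rintro ⟨⟨hB, hdiag⟩, hres, h0, h0'⟩
      have hB0 : B = (0, 0, c + 1) := by
        obtain ⟨i, r, c'⟩ := B
        simp only at h0 h0'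
        subst h0 h0'
        simp [hD] at hB
        have := hdiag 0 0 c' (by simp) 0 (c + 1) (by omega) (by omega)
        simp [hD] at this
        rw [this]
      subst hB0
      refine ⟨rfl, ?_⟩
      simp [res] at hres
      linear_combination hres
    · rintro ⟨rfl, hc⟩
      refine ⟨⟨by simp [hD], ?_⟩, ?_, rfl, rfl⟩
      · intro i r c' h r' c'' hr hc'
        simp only [Finset.mem_insert, hD, Prod.mk.injEq] at h ⊢
        omega
      · simp [res]
        linear_combination hc
  have h₂ : ({B : Node | Removable D B ∧ res (![0, 0] : Fin 2 → ZMod e) B = res ![0, 0] (0, 1, c) ∧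
      Above B (0, 1, c)}.ncard : ℤ) = if False then 1 else 0 := by
    refine ncard_singleton_if (A := (0, 0, 0)) fun B => ?_
    simp only [Set.mem_ofPred_eq, habove, and_false, iff_false]
    rintro ⟨⟨hB, hdiag⟩, -, h0, h0'⟩
    obtain ⟨i, r, c'⟩ := B
    simp only at h0 h0'
    subst h0 h0'
    simp [hD] at hB
    have := hdiag 0 1 c' (by simp [hD, hB]) 0 c' (by omega) le_rfl
    simp at this
  rw [dAbove, h₁, h₂, if_neg not_false, sub_zero]

theorem mem_image_le {n : ℕ} {T : Fin n → Node} {f : ℕ → Node} (hT : ∀ t, T t = f t) (r : Fin n)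
    (x : Node) : x ∈ (Finset.univ.filter (fun s : Fin n => s ≤ r)).image T
      ↔ ∃ s : ℕ, s ≤ r ∧ f s = x := by
  simp only [Finset.mem_image, Finset.mem_filter, Finset.mem_univ, true_and, hT]
  constructor
  · rintro ⟨s, hs, rfl⟩
    exact ⟨s, hs, rfl⟩
  · rintro ⟨s, hs, rfl⟩
    exact ⟨⟨s, by omega⟩, hs, rfl⟩

theorem sum_range_natCast_eq_zero (he : 1 ≤ e) (j : ℕ) :
    ∑ t ∈ Finset.range (j * e), (if (t : ZMod e) = 0 then (1 : ℤ) else 0) = j := by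
  induction j with
  | zero => simp
  | succ j ih =>
    rw [Nat.succ_mul, Finset.sum_range_add, ih, Finset.sum_eq_single 0]
    · simp
    · intro t ht h0
      have := natCast_zmod_ne_zero (e := e) (Nat.pos_of_ne_zero h0) (Finset.mem_range.1 ht)
      simp [this]
    · intro h
      exact absurd (Finset.mem_range.2 (by omega)) h

theorem codeg_rowPair (he : 2 ≤ e) (j k : ℕ) (κ : Fin 2 → ZMod e) (hκ : κ = ![0, 0]) :
    codeg κ (colInitial (rowPair e j k)) = j := by
  have key : ∀ r : Fin (k * e + j * e), dAbove κ ((Finset.univ.filter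
      (fun s : Fin (k * e + j * e) => s ≤ r)).image (colInitial (rowPair e j k)))
      (colInitial (rowPair e j k) r)
      = if (r : ℕ) < j * e then (if ((r : ℕ) : ZMod e) = 0 then 1 else 0) else 0 := by
    intro r
    have hr : colInitial (rowPair e j k) r = rowPairNode (j * e) r := colInitial_rowPair e j k r
    rw [hr, hκ, rowPairNode]
    by_cases h₁ : (r : ℕ) < j * e
    · rw [if_pos h₁, if_pos h₁]
      refine dAbove_second_component _ fun x => ?_
      rw [mem_image_le (colInitial_rowPair e j k)]
      constructor
      · rintro ⟨s, hs, rfl⟩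
        rw [rowPairNode, if_pos (by omega)]
        exact ⟨rfl, rfl, hs⟩
      · obtain ⟨i, a, b⟩ := x
        rintro ⟨rfl, rfl, hb⟩
        simp only at hb
        exact ⟨b, hb, by rw [rowPairNode, if_pos (by omega)]⟩
    · rw [if_neg h₁, if_neg h₁, dAbove_first_row]
  rw [codeg, Finset.sum_congr rfl fun r _ => key r]
  rw [Fin.sum_univ_eq_sum_range (fun r => if r < j * e then
    (if (r : ZMod e) = 0 then (1 : ℤ) else 0) else 0) (k * e + j * e), add_comm (k * e),
    Finset.sum_range_add, Finset.sum_eq_zero (s := Finset.range (k * e)), add_zero,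
    ← sum_range_natCast_eq_zero (e := e) (by omega) j]
  · exact Finset.sum_congr rfl fun t ht => if_pos (Finset.mem_range.1 ht)
  · intro t _
    exact if_neg (by omega)

theorem stepDeg_gammaPath_tail {m t : ℕ} (he : 2 ≤ e) (hm : e ≤ m) (h : 2 * m - e + 1 ≤ t) :
    stepDeg e (gammaPath e m) t = 0 := by
  rw [stepDeg, if_pos]
  unfold gammaPath
  omega

/-- The equality holds entry by entry: each node of `t_λ` contributes exactly the degree of the
corresponding step of `gammaPath`. All steps from `2je - e + 1` on are level and contribute nothing.
-/
theorem codeg_twoRowPair (j k : ℕ) (he : 2 ≤ e) (hj : 1 ≤ j) (hjk : j ≤ k) (κ : Fin 2 → ZMod e)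
    (hκ : κ = ![0, 0]) :
    codeg κ (colInitial (twoRowPair e j k he hj hjk))
      = pathDeg e (2 * (j * e) - e + 2) (gammaPath e (j * e)) := by
  have hm : e ≤ j * e := by nlinarith
  have hmk : j * e ≤ k * e := Nat.mul_le_mul_right e hjk
  have hinit := colInitial_twoRowPair e j k he hj hjk
  have key : ∀ r : Fin (k * e + j * e), dAbove κ ((Finset.univ.filter
      (fun s : Fin (k * e + j * e) => s ≤ r)).image (colInitial (twoRowPair e j k he hj hjk)))
      (colInitial (twoRowPair e j k he hj hjk) r) = stepDeg e (gammaPath e (j * e)) r := by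
    intro r
    have hr : colInitial (twoRowPair e j k he hj hjk) r = twoRowPairNode e (j * e) r := hinit r
    have hmem := mem_image_le hinit r
    rw [hr, hκ]
    generalize (Finset.univ.filter (fun s : Fin (k * e + j * e) => s ≤ r)).image
      (colInitial (twoRowPair e j k he hj hjk)) = D at hmem ⊢
    generalize (r : ℕ) = t at hmem ⊢
    generalize j * e = m at hm hmem ⊢
    rcases twoRowPairNode_cases he hm t with ⟨h, h'⟩ | ⟨i, hi, h, h'⟩ | ⟨i, hi, h, h'⟩ | ⟨h, h'⟩
    · have hfirst : ∀ s, s ≤ t → twoRowPairNode e m s = (1, 0, s) := fun s hs =>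
        if_pos (by omega)
      rw [h', dAbove_second_component]
      · have g : gammaPath e m t = t := by unfold gammaPath; omega
        have g' : gammaPath e m (t + 1) = t + 1 := by unfold gammaPath; omega
        have hne := natCast_zmod_ne_zero (e := e) (a := t + 1) (by omega) (by omega)
        push_cast at hne
        rw [stepDeg, g, g', if_neg (show ¬ t + 1 = t by omega),
          if_neg (show ¬ (t : ZMod e) = 2 * t + 1 from fun h => hne (by linear_combination -h)),
          sub_zero]
        refine if_congr ⟨fun h => ?_, fun h => ?_⟩ rfl rfl <;> linear_combination -h
      · intro x
        rw [hmem]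
        constructor
        · rintro ⟨s, hs, rfl⟩
          rw [hfirst s hs]
          exact ⟨rfl, rfl, hs⟩
        · obtain ⟨i, a, b⟩ := x
          rintro ⟨rfl, rfl, hb⟩
          exact ⟨b, hb, hfirst b hb⟩
    · rw [h', dAbove_first_row, stepDeg, if_pos]
      unfold gammaPath
      omega
    · rw [h', dAbove_second_row (e - 1) i]
      · have hone := one_ne_zero_zmod he
        have ecast : ((e - 1 : ℕ) : ZMod e) = -1 := by
          rw [Nat.cast_sub (by omega), ZMod.natCast_self]; simp
        rw [h, stepDeg, gammaPath_next he hi hm, gammaPath_odd he hi hm,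
          if_neg (show ¬ e + i = e - 1 + i by omega)]
        push_cast [ecast, ZMod.natCast_self]
        rw [if_neg (show ¬ 0 + 2 * (i : ZMod e) = 2 * (-1 + i) + 1 from
          fun h => hone (by linear_combination h)), sub_zero]
        refine if_congr ⟨fun h => ?_, fun h => ?_⟩ rfl rfl <;> linear_combination h
      · intro x
        rw [hmem]
        constructor
        · rintro ⟨s, hs, rfl⟩
          rcases twoRowPairNode_cases he hm s with
            ⟨l, l'⟩ | ⟨i', hi', l, l'⟩ | ⟨i', hi', l, l'⟩ | ⟨l, l'⟩
          · rw [l']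
            exact Or.inl ⟨rfl, rfl, l⟩
          · rw [l']
            exact Or.inr ⟨rfl, by simp, by simp only; omega⟩
          · rw [l']
            exact Or.inr ⟨rfl, by simp, by simp only; omega⟩
          · omega
        · obtain ⟨i', a, b⟩ := x
          rintro (⟨rfl, rfl, hb⟩ | ⟨rfl, ha, hb⟩)
          · simp only at hb
            exact ⟨b, by omega, if_pos hb⟩
          · simp only at ha hb
            refine ⟨e - 1 + 2 * b + a, by omega, ?_⟩
            rw [twoRowPairNode, if_neg (by omega), twoRowNode, if_pos (by omega),
              show (e - 1 + 2 * b + a - (e - 1)) % 2 = a by omega,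
              show (e - 1 + 2 * b + a - (e - 1)) / 2 = b by omega]
    · rw [h', dAbove_first_row, stepDeg_gammaPath_tail he hm h]
  rw [codeg, Finset.sum_congr rfl fun r _ => key r,
    Fin.sum_univ_eq_sum_range (fun r => stepDeg e (gammaPath e (j * e)) r), pathDeg]
  refine (Finset.sum_subset (Finset.range_subset_range.2 (by omega)) fun t _ ht => ?_).symm
  exact stepDeg_gammaPath_tail he hm (by rw [Finset.mem_range] at ht; omega)

end Codegree

/-! ### Universal property of the cyclic modules -/

section Specht

variable {F : Type*} [Field F] {e n : ℕ} [NeZero e] {κ : Fin 2 → ZMod e} {ν : Bipartition n}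
variable {K : Set (CycKLR F n κ)}

theorem smul_gen (x : CycKLR F n κ) :
    x • gen F κ ν K = (spechtIdeal F κ ν K).mkQ x := by
  rw [gen, ← Submodule.mkQ_apply, ← map_smul, smul_eq_mul, mul_one]

theorem smul_gen_eq_zero {x : CycKLR F n κ} (h : x ∈ spechtIdeal F κ ν K) :
    x • gen F κ ν K = 0 := by
  rw [smul_gen, Submodule.mkQ_apply, Submodule.Quotient.mk_eq_zero]
  exact h

theorem idem_smul_gen : idem F κ (colResidues κ ν) • gen F κ ν K = gen F κ ν K := by
  have h : idem F κ (colResidues κ ν) - 1 ∈ spechtIdeal F κ ν K :=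
    Submodule.subset_span (Or.inl (Or.inl rfl))
  have := smul_gen_eq_zero h
  rwa [sub_smul, one_smul, sub_eq_zero] at this

theorem y_smul_gen (r : ℕ) : y F n κ r • gen F κ ν K = 0 := by
  by_cases h : 1 ≤ r ∧ r ≤ n
  · exact smul_gen_eq_zero (Submodule.subset_span (Or.inl (Or.inr ⟨r, h.1, h.2, rfl⟩)))
  · rw [y_out F n κ r h, zero_smul]

/-- A vector killed by the defining relators of a cyclic module is the image of its generator. -/
theorem exists_linearMap_gen {M : Type*} [AddCommGroup M] [Module (CycKLR F n κ) M] (v : M)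
    (hv : idem F κ (colResidues κ ν) • v = v) (hy : ∀ r, y F n κ r • v = 0)
    (hK : ∀ x ∈ K, x • v = 0) :
    ∃ γ : SpechtOf F κ ν K →ₗ[CycKLR F n κ] M,
      ∀ x, γ ((spechtIdeal F κ ν K).mkQ x) = x • v := by
  refine ⟨(spechtIdeal F κ ν K).liftQ (LinearMap.toSpanSingleton _ M v) ?_, fun x => rfl⟩
  refine Submodule.span_le.2 ?_
  rintro x ((rfl | ⟨r, -, -, rfl⟩) | hx)
  · change (idem F κ (colResidues κ ν) - 1) • v = 0
    rw [sub_smul, one_smul, hv, sub_self]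
  · exact hy r
  · exact hK x hx

end Specht

/-! ### Assembling the homomorphism -/

section Main

variable {F : Type*} [Field F] {e : ℕ} [NeZero e] {κ : Fin 2 → ZMod e}

theorem isRowVector_gen (hκ : κ = ![0, 0]) (j k : ℕ) :
    IsRowVector F (k * e + j * e) κ (j * e)
      (gen F κ (rowPair e j k) (rowPairRelators F κ j k)) where
  idem_smul := by rw [← colResidues_rowPair e j k κ hκ, idem_smul_gen]
  y_smul := y_smul_gen
  psi_smul r h₁ h₂ h₃ :=
    smul_gen_eq_zero (Submodule.subset_span (Or.inr ⟨r, h₁, by omega, h₃, rfl⟩))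

end Main

end BihookSpecht

open BihookSpecht in
theorem mainTheorem10 (F : Type*) [Field F] (e : ℕ) [NeZero e] (he : 2 ≤ e)
    (j k : ℕ) (hj : 1 ≤ j) (hjk : j ≤ k) (κ : Fin 2 → ZMod e) (hκ : κ = ![0, 0]) :
    ∃ γ : SpechtOf F κ (twoRowPair e j k he hj hjk) (twoRowPairRelators F κ j k)
        →ₗ[CycKLR F (k * e + j * e) κ] SpechtOf F κ (rowPair e j k) (rowPairRelators F κ j k),
      γ (gen F κ (twoRowPair e j k he hj hjk) (twoRowPairRelators F κ j k))
          = psiTab F κ (k * e + j * e) (j * e) (gammaEntry e)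
            • gen F κ (rowPair e j k) (rowPairRelators F κ j k) ∧
      ∀ (d : ℤ), ∀ x ∈ spechtDeg F κ (twoRowPair e j k he hj hjk) (twoRowPairRelators F κ j k) d,
        γ x ∈ spechtDeg F κ (rowPair e j k) (rowPairRelators F κ j k) (d + (j : ℤ)) := by
  have hm : e ≤ j * e := by nlinarith
  have hmk : j * e ≤ k * e := Nat.mul_le_mul_right e hjk
  have hN : 2 * (j * e) - e + 2 ≤ k * e + j * e := by omega
  have hz := isRowVector_gen (F := F) hκ j k
  obtain ⟨γ, hγ⟩ := exists_linearMap_gen (F := F) (κ := κ) (ν := twoRowPair e j k he hj hjk)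
    (K := twoRowPairRelators F κ j k)
    (psiTab F κ (k * e + j * e) (j * e) (gammaEntry e)
      • gen F κ (rowPair e j k) (rowPairRelators F κ j k))
    (by rw [colResidues_twoRowPair e j k he hj hjk κ hκ, hz.idem_smul_gamma he hm hN])
    (hz.y_smul_gamma he hm hN) (by
      rintro x ((((⟨r, h₁, h₂, rfl⟩ | ⟨i, hi, rfl⟩) | ⟨r, h₁, h₂, rfl⟩) | ⟨i, hi, rfl⟩) |
        ⟨i, h₁, h₂, rfl⟩)
      · exact hz.psi_smul_gamma_of_far he hm h₁ (by omega) (by omega)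
      · exact hz.psi_smul_gamma he hm hN hi
      · exact hz.psi_smul_gamma_of_far he hm (by omega) (by omega) (by omega)
      · rw [mul_smul]
        exact hz.psi_psi_smul_gamma_up he hm hN hi
      -- Here `i ≥ 1`; the shift turns `e + 2i - 1` into `e + 2i' + 1` and removes the truncated
      -- subtraction.
      · obtain ⟨i, rfl⟩ : ∃ i', i = i' + 1 := ⟨i - 1, by omega⟩
        rw [mul_smul]
        exact hz.psi_psi_smul_gamma_down he hm hN h₂)
  refine ⟨γ, ?_, ?_⟩
  · rw [gen, ← Submodule.mkQ_apply, hγ, one_smul]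
  · rintro d _ ⟨a, ha, rfl⟩
    obtain ⟨L, hL⟩ := (pathOf_gammaEntry he hm).reach_psiTab (F := F) (n := k * e + j * e) (κ := κ)
      (z := idem F κ (pathSeq e (k * e + j * e) fun p => min p (j * e)))
    -- The idempotent on the right makes the representative homogeneous. It may be inserted because
    -- it fixes the generator `z_μ`.
    refine ⟨a * (psiTab F κ (k * e + j * e) (j * e) (gammaEntry e)
        * idem F κ (pathSeq e (k * e + j * e) fun p => min p (j * e))), ?_, ?_⟩
    · have h := hL.mul_mem_klrDeg hN ha
      rw [pathDeg_initial (Dvd.intro_left j rfl) (by omega), codeg_twoRowPair j k he hj hjk κ hκ]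
        at h
      rw [codeg_rowPair he j k κ hκ]
      rwa [sub_zero, sub_add_cancel, ← add_sub_cancel_right d (j : ℤ)] at h
    · change (spechtIdeal F κ _ _).mkQ _ = γ ((spechtIdeal F κ _ _).mkQ a)
      rw [hγ, ← smul_gen, mul_smul, mul_smul, hz.idem_smul]
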